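/- Let $\mathcal F$ be a skew field, $n\ge 1$, $G=GL_n(\mathcal F)$. Let $H$, $B$, $B^-$, $U$ be the subgroups of $G$ of diagonal, upper triangular, lower triangular and upper unitriangular matrices. $S_n$ acts by permutation matrices ($e_j\mapsto e_{w(j)}$), $s_i=(i,i+1)$, $\ell(w)$ is the number of inversions of $w$. For $1\le i\le n-1$ let $\varphi_i:GL_2(\mathcal F)\to G$ be the embedding in the rows and columns $i,i+1$, and put $$x_i(t)=\varphi_i\begin{pmatrix}1&t\\0&1\end{pmatrix},\quad x_{-i}(t)=\varphi_i\begin{pmatrix}t^{-1}&0\\1&t\end{pmatrix},\quad \overline{s_i}=\varphi_i\begin{pmatrix}0&-1\\1&0\end{pmatrix};$$ $\overline w$ is the representative of $w\in S_n$ determined by the $\overline{s_i}$ and $\overline{uv}=\overline u\,\overline v$ whenever $\ell(uv)=\ell(u)+\ell(v)$. For a square matrix $A$ the quasideterminant $|A|_{ij}=a_{ij}-r_i(A^{ij})^{-1}c_j$ is defined if $A^{ij}$ ($A$ without row $i$ and column $j$) is invertible; here $r_i$ is the $i$-th row without $a_{ij}$ and $c_j$ the $j$-th column without $a_{ij}$.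 For $u,v\in S_n$, $k\in[1,n]$, $I=u([1,k])$, $J=v([1,k])$, let $$\Delta^k_{u,v}(x)=(-1)^{d+d'}\,|x_{I,J}|_{u(k),v(k)},$$ where $d$ is the number of elements of $I$ greater than $u(k)$ and $d'$ the number of elements of $J$ greater than $v(k)$. An element $g$ of $G_0=B^-U$ is written uniquely as $g=[g]_-[g]_+$ with $[g]_-\in B^-$, $[g]_+\in U$. Let $x^\iota=Jx^{-1}J$ with $J=\mathrm{diag}(-1,1,\dots,(-1)^n)$. Let $G^{u,v}=BuB\cap B^-vB^-$ and $L^{u,v}=U\overline uU\cap B^-vB^-$. The twist $\psi^{u,v}$ is defined on $L^{u,v}$ by $$\psi^{u,v}(x)=([x\,\overline{v^{-1}}]_-)^\iota\,(x^\iota)^{-1}\,([\overline u^{\,-1}x]_+)^\iota$$ and extended to $G^{u,v}=HL^{u,v}$ by $\psi^{u,v}(hx)=h\,\psi^{u,v}(x)$ for $h\in H$, $x\in L^{u,v}$. **Statement.** Let $(i_1,\dots,i_m)$ be a reduced word for $w\in S_n$, let $t_1,\dots,t_m$ be non-zero elements of $\mathcal F$ and let $h=\mathrm{diag}(h_1,\dots,h_n)\in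 H$. All quasiminors below are defined, and the inverted ones are non-zero. (i) Let $x_0=x_{i_1}(t_1)\cdots x_{i_m}(t_m)$ and $x=hx_0$. Then $x_0\in L^{e,w}$, $x\in G^{e,w}$, $x_0\overline{w^{-1}}\in G_0$, and $y=\psi^{e,w}(x)$ equals $h\,([x_0\overline{w^{-1}}]_-)^\iota$. One has $$h_i=\Delta^i_{e,e}(x)=x_{ii}\qquad(i\in[1,n]),$$ and for $k\in[1,m]$, with $i=i_k$, $$t_k=\Delta^i_{s_{i_1}\cdots s_{i_k},e}(y)^{-1}\,\Delta^{i+1}_{s_{i_1}\cdots s_{i_{k-1}},e}(y)=\Delta^i_{s_{i_1}\cdots s_{i_{k-1}},e}(y)^{-1}\,\Delta^{i+1}_{s_{i_1}\cdots s_{i_k},e}(y).$$ (ii) Let $x_0=x_{-i_1}(t_1)\cdots x_{-i_m}(t_m)$ and $x=hx_0$. Then $x_0\in L^{w,e}$, $x\in G^{w,e}$, $\overline w^{\,-1}x\in G_0$, and $y=\psi^{w,e}(x)$ equals $h\,([\overline w^{\,-1}x]_+)^\iota$. One has $$h_i=\Delta^{w^{-1}(i)}_{w,e}(x)\qquad(i\in[1,n]),$$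 and for $k\in[1,m]$, with $i=i_k$, $$t_k=\Delta^i_{e,s_{i_m}\cdots s_{i_{k+1}}}(y)^{-1}\,\Delta^i_{e,s_{i_m}\cdots s_{i_k}}(y)=\Delta^{i+1}_{e,s_{i_m}\cdots s_{i_k}}(y)^{-1}\,\Delta^{i+1}_{e,s_{i_m}\cdots s_{i_{k+1}}}(y);$$ the last two formulas also hold with $y$ replaced by $([\overline w^{\,-1}x]_+)^\iota$. -/

import Mathlib

namespace NCTwist

/-! ### Quasideterminants -/

section Quasideterminants

variable {R : Type*} [Ring R]

/-- `B` is a two-sided inverse of the matrix `A` (rows and columns of `A` may be indexed by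
different types). -/
def IsMatInv {ι κ : Type*} [Fintype ι] [Fintype κ] [DecidableEq ι] [DecidableEq κ]
    (A : Matrix ι κ R) (B : Matrix κ ι R) : Prop :=
  A * B = 1 ∧ B * A = 1

/-- The matrix `A` is invertible over `R`. -/
def MatInvertible {ι κ : Type*} [Fintype ι] [Fintype κ] [DecidableEq ι] [DecidableEq κ]
    (A : Matrix ι κ R) : Prop :=
  ∃ B : Matrix κ ι R, IsMatInv A B

theorem IsMatInv.unique {ι κ : Type*} [Fintype ι] [Fintype κ] [DecidableEq ι] [DecidableEq κ]
    {A : Matrix ι κ R} {B C : Matrix κ ι R} (hB : IsMatInv A B) (hC : IsMatInv A C) : B = C := by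
  calc B = B * (A * C) := by rw [hC.1, Matrix.mul_one]
    _ = C := by rw [← Matrix.mul_assoc, hB.2, Matrix.one_mul]

open Classical in
/-- The inverse of an invertible matrix (`0` if the matrix is not invertible). -/
noncomputable def matInv {ι κ : Type*} [Fintype ι] [Fintype κ] [DecidableEq ι] [DecidableEq κ]
    (A : Matrix ι κ R) : Matrix κ ι R :=
  if h : MatInvertible A then h.choose else 0

theorem IsMatInv.matInv_eq {ι κ : Type*} [Fintype ι] [Fintype κ] [DecidableEq ι] [DecidableEq κ]
    {A : Matrix ι κ R} {B : Matrix κ ι R} (hB : IsMatInv A B) : matInv A = B := by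
  have h : MatInvertible A := ⟨B, hB⟩
  rw [matInv, dif_pos h]
  exact h.choose_spec.unique hB

/-- The submatrix `A^{ij}`: the `i`-th row and the `j`-th column are deleted. -/
def deleteRowCol {ι κ : Type*} (A : Matrix ι κ R) (i : ι) (j : κ) :
    Matrix {p : ι // p ≠ i} {q : κ // q ≠ j} R :=
  A.submatrix Subtype.val Subtype.val

/-- The quasideterminant `|A|_{ij}` is defined: `A^{ij}` is invertible (this is automatic for a
`1 × 1` matrix, where `A^{ij}` is the empty matrix). -/
def QuasidetDefined {ι κ : Type*} [Fintype ι] [Fintype κ] [DecidableEq ι] [DecidableEq κ]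
    (A : Matrix ι κ R) (i : ι) (j : κ) : Prop :=
  MatInvertible (deleteRowCol A i j)

/-- The quasideterminant `|A|_{ij} = a_{ij} - r_i (A^{ij})⁻¹ c_j`. -/
noncomputable def quasidet {ι κ : Type*} [Fintype ι] [Fintype κ] [DecidableEq ι] [DecidableEq κ]
    (A : Matrix ι κ R) (i : ι) (j : κ) : R :=
  A i j - ∑ q : {q : κ // q ≠ j}, ∑ p : {p : ι // p ≠ i},
    A i q * matInv (deleteRowCol A i j) q p * A p j

/-- The submatrix `x_{I,J}` with the rows `I` and the columns `J`. -/
def subMat {n : ℕ} (x : Matrix (Fin n) (Fin n) R) (I J : Finset (Fin n)) : Matrix I J R :=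
  x.submatrix Subtype.val Subtype.val

/-- The number of elements of `I` which are greater than `i`. -/
def numGreater {n : ℕ} (I : Finset (Fin n)) (i : Fin n) : ℕ :=
  (I.filter fun a => i < a).card

/-- The positive quasiminor
`Δ^{i,j}_{I,J}(x) = (-1)^{d_i(I) + d_j(J)} |x_{I,J}|_{i,j}`. -/
noncomputable def posQuasiminor {n : ℕ} (I J : Finset (Fin n)) (i : I) (j : J)
    (x : Matrix (Fin n) (Fin n) R) : R :=
  (-1) ^ (numGreater I i + numGreater J j) * quasidet (subMat x I J) i j

/-- The image under `u` of the initial segment of the index set that ends in `k`. -/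
def imageInit {n : ℕ} (u : Equiv.Perm (Fin n)) (k : Fin n) : Finset (Fin n) :=
  (Finset.Iic k).map u.toEmbedding

/-- `u k` as an element of `imageInit u k`. -/
def lastOf {n : ℕ} (u : Equiv.Perm (Fin n)) (k : Fin n) : imageInit u k :=
  ⟨u k, Finset.mem_map_of_mem u.toEmbedding (Finset.mem_Iic.mpr le_rfl)⟩

/-- The positive quasiminor `Δ^k_{u,v} = Δ^{u(k),v(k)}_{u[1,k],v[1,k]}`. Indices start at `0` in
`Fin n`, so `k : Fin n` stands for the superscript `k + 1`. -/
noncomputable def Delta {n : ℕ} (k : Fin n) (u v : Equiv.Perm (Fin n))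
    (x : Matrix (Fin n) (Fin n) R) : R :=
  posQuasiminor (imageInit u k) (imageInit v k) (lastOf u k) (lastOf v k) x

/-- The positive quasiminor `Δ^k_{u,v}(x)` is defined. -/
def DeltaDefined {n : ℕ} (k : Fin n) (u v : Equiv.Perm (Fin n))
    (x : Matrix (Fin n) (Fin n) R) : Prop :=
  QuasidetDefined (subMat x (imageInit u k) (imageInit v k)) (lastOf u k) (lastOf v k)

end Quasideterminants

/-! ### Permutations and reduced words -/

section Words

/-- The number of inversions of a permutation. -/
def invNum {n : ℕ} (w : Equiv.Perm (Fin n)) : ℕ :=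
  (Finset.univ.filter fun p : Fin n × Fin n => p.1 < p.2 ∧ w p.2 < w p.1).card

/-- The simple transposition of two neighbouring indices: the letter `i : Fin r` (the `i + 1`-st
one) exchanges the positions `i` and `i + 1` of `Fin (r + 1)`. -/
def simpleRefl {r : ℕ} (i : Fin r) : Equiv.Perm (Fin (r + 1)) :=
  Equiv.swap i.castSucc i.succ

/-- The list `s_{i_1}, …, s_{i_m}`. -/
def reflList {r m : ℕ} (i : Fin m → Fin r) : List (Equiv.Perm (Fin (r + 1))) :=
  List.ofFn fun k => simpleRefl (i k)

/-- The word `i_1, …, i_m` is a reduced word for `w`. -/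
def IsReducedWord {r m : ℕ} (i : Fin m → Fin r) (w : Equiv.Perm (Fin (r + 1))) : Prop :=
  (reflList i).prod = w ∧ invNum w = m

/-- The product `s_{i_1} ⋯ s_{i_k}` of the first `k` reflections of a word. -/
def prefixProd {r m : ℕ} (i : Fin m → Fin r) (k : ℕ) : Equiv.Perm (Fin (r + 1)) :=
  ((reflList i).take k).prod

/-- The product `s_{i_m} ⋯ s_{i_{k+1}}` of the reflections of a word that follow the first `k`
ones, in the reversed order. -/
def revSuffixProd {r m : ℕ} (i : Fin m → Fin r) (k : ℕ) : Equiv.Perm (Fin (r + 1)) :=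
  ((reflList i).drop k).reverse.prod

end Words

/-! ### The general linear group over a skew field -/

section Group

variable {F : Type*} [DivisionRing F]

/-- The subgroup `B` of upper triangular matrices. -/
def upperB (F : Type*) [DivisionRing F] (n : ℕ) : Set (GL (Fin n) F) :=
  {g | ∀ a b : Fin n, b < a → g.val a b = 0}

/-- The subgroup `B⁻` of lower triangular matrices. -/
def lowerB (F : Type*) [DivisionRing F] (n : ℕ) : Set (GL (Fin n) F) :=
  {g | ∀ a b : Fin n, a < b → g.val a b = 0}

/-- The subgroup `U` of upper unitriangular matrices. -/
def upperU (F : Type*) [DivisionRing F] (n : ℕ) : Set (GL (Fin n) F) :=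
  {g | g ∈ upperB F n ∧ ∀ a : Fin n, g.val a a = 1}

/-- The diagonal matrix `diag(h_1, …, h_n)`; these form the subgroup `H`. -/
def diagGL {n : ℕ} (h : Fin n → Fˣ) : GL (Fin n) F where
  val := Matrix.diagonal fun a => (h a : F)
  inv := Matrix.diagonal fun a => ((h a)⁻¹ : Fˣ)
  val_inv := by simp [Matrix.diagonal_mul_diagonal]
  inv_val := by simp [Matrix.diagonal_mul_diagonal]

/-- The permutation matrix of `u`: it sends the basis vector `e_b` to `e_{u(b)}`. -/
def permGL {n : ℕ} (u : Equiv.Perm (Fin n)) : GL (Fin n) F where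
  val := Matrix.of fun a b => if a = u b then 1 else 0
  inv := Matrix.of fun a b => if u a = b then 1 else 0
  val_inv := by
    ext a b
    rw [Matrix.mul_apply, Finset.sum_eq_single (u.symm a)]
    · simp [Matrix.one_apply]
    · intro c _ hc
      have : a ≠ u c := fun h => hc (by simp [h])
      simp [this]
    · simp
  inv_val := by
    ext a b
    rw [Matrix.mul_apply, Finset.sum_eq_single (u a)]
    · simp [Matrix.one_apply]
    · intro c _ hc
      simp [Ne.symm hc]
    · simp

/-- The column-wise sign: the parity of the number of inversions of `u` in which `b` is the greater
position. -/
def colSign (F : Type*) [DivisionRing F] {n : ℕ} (u : Equiv.Perm (Fin n)) (b : Fin n) : Fˣ :=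
  (-1) ^ (Finset.univ.filter fun a : Fin n => a < b ∧ u b < u a).card

/-- The representative `ū` of the permutation `u`. It is the one with
`s̄_i = φ_i (0 -1; 1 0)` and `(uv)‾ = ū v̄` whenever `ℓ(uv) = ℓ(u) + ℓ(v)`;
see `permLift_simpleRefl` and `permLift_mul`. -/
def permLift {n : ℕ} (u : Equiv.Perm (Fin n)) : GL (Fin n) F :=
  permGL u * diagGL (colSign F u)

/-- The two positions `i`, `i + 1` of the `i`-th `2 × 2` block. -/
def blockPos {r : ℕ} (i : Fin r) : Fin 2 → Fin (r + 1) :=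
  ![i.castSucc, i.succ]

/-- The `n × 2` incidence matrix of the two positions `i`, `i + 1`. -/
def blockInc (F : Type*) [DivisionRing F] {r : ℕ} (i : Fin r) :
    Matrix (Fin (r + 1)) (Fin 2) F :=
  Matrix.of fun a p => if a = blockPos i p then 1 else 0

theorem blockInc_transpose_mul {r : ℕ} (i : Fin r) :
    (blockInc F i).transpose * blockInc F i = 1 := by
  have h : i.castSucc ≠ i.succ := (Fin.castSucc_lt_succ (i := i)).ne
  ext p q
  rw [Matrix.mul_apply, Finset.sum_eq_single (blockPos i p)]
  · fin_cases p <;> fin_cases q <;> simp [blockInc, blockPos, h, h.symm]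
  · intro b _ hb
    simp [blockInc, hb]
  · simp

/-- The matrix that has the block `M` at the intersection of the rows and columns `i`, `i + 1`,
and agrees with the identity matrix elsewhere. -/
def blockMat {r : ℕ} (i : Fin r) (M : Matrix (Fin 2) (Fin 2) F) :
    Matrix (Fin (r + 1)) (Fin (r + 1)) F :=
  1 + blockInc F i * (M - 1) * (blockInc F i).transpose

theorem blockMat_one {r : ℕ} (i : Fin r) : blockMat i (1 : Matrix (Fin 2) (Fin 2) F) = 1 := by
  simp [blockMat]

theorem blockMat_mul {r : ℕ} (i : Fin r) (M N : Matrix (Fin 2) (Fin 2) F) :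
    blockMat i (M * N) = blockMat i M * blockMat i N := by
  have key : blockInc F i * (M - 1) * (blockInc F i).transpose *
      (blockInc F i * (N - 1) * (blockInc F i).transpose) =
      blockInc F i * ((M - 1) * (N - 1)) * (blockInc F i).transpose := by
    calc _ = blockInc F i * (M - 1) * ((blockInc F i).transpose * blockInc F i) * (N - 1) *
          (blockInc F i).transpose := by simp only [Matrix.mul_assoc]
      _ = _ := by rw [blockInc_transpose_mul]; simp only [Matrix.mul_assoc, Matrix.one_mul]
  have e : M * N - 1 = (M - 1) + (N - 1) + (M - 1) * (N - 1) := by noncomm_ring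
  unfold blockMat
  rw [e, add_mul, mul_add, mul_add, one_mul, mul_one, key]
  simp only [Matrix.mul_add, Matrix.add_mul, one_mul]
  abel

/-- The embedding `φ_i : GL_2(F) → GL_n(F)`. -/
def phi {r : ℕ} (i : Fin r) : GL (Fin 2) F →* GL (Fin (r + 1)) F :=
  Units.map
    { toFun := blockMat i
      map_one' := blockMat_one i
      map_mul' := blockMat_mul i }

theorem phi_apply_block {r : ℕ} (i : Fin r) (M : GL (Fin 2) F) (p q : Fin 2) :
    (phi i M).val (blockPos i p) (blockPos i q) = M.val p q := by
  have h : i.castSucc ≠ i.succ := (Fin.castSucc_lt_succ (i := i)).ne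
  change blockMat i M.val _ _ = _
  fin_cases p <;> fin_cases q <;>
    simp [blockMat, blockInc, blockPos, Matrix.mul_apply, h, h.symm]

theorem phi_apply_left {r : ℕ} (i : Fin r) (M : GL (Fin 2) F) (a b : Fin (r + 1))
    (ha : a ≠ i.castSucc ∧ a ≠ i.succ) : (phi i M).val a b = if a = b then 1 else 0 := by
  change blockMat i M.val _ _ = _
  simp [blockMat, blockInc, blockPos, Matrix.mul_apply, ha.1, ha.2, Matrix.one_apply]

theorem phi_apply_right {r : ℕ} (i : Fin r) (M : GL (Fin 2) F) (a b : Fin (r + 1))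
    (hb : b ≠ i.castSucc ∧ b ≠ i.succ) : (phi i M).val a b = if a = b then 1 else 0 := by
  change blockMat i M.val _ _ = _
  simp [blockMat, blockInc, blockPos, Matrix.mul_apply, hb.1, hb.2, Matrix.one_apply]

/-- `x_i(t) = φ_i (1 t; 0 1) = I + t E_{i,i+1}`. -/
def xPos {r : ℕ} (i : Fin r) (t : F) : GL (Fin (r + 1)) F :=
  phi i
    { val := !![1, t; 0, 1]
      inv := !![1, -t; 0, 1]
      val_inv := by simp [Matrix.one_fin_two]
      inv_val := by simp [Matrix.one_fin_two] }

/-- `x_{-i}(t) = φ_i (t⁻¹ 0; 1 t)`. -/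
def xNeg {r : ℕ} (i : Fin r) (t : Fˣ) : GL (Fin (r + 1)) F :=
  phi i
    { val := !![((t⁻¹ : Fˣ) : F), 0; 1, (t : F)]
      inv := !![(t : F), 0; -1, ((t⁻¹ : Fˣ) : F)]
      val_inv := by simp [Matrix.one_fin_two]
      inv_val := by simp [Matrix.one_fin_two] }

/-- The product `x_{i_1}(t_1) ⋯ x_{i_m}(t_m)`. -/
def prodPos {r m : ℕ} (i : Fin m → Fin r) (t : Fin m → Fˣ) : GL (Fin (r + 1)) F :=
  (List.ofFn fun k => xPos (i k) (t k : F)).prod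

/-- The product `x_{-i_1}(t_1) ⋯ x_{-i_m}(t_m)`. -/
def prodNeg {r m : ℕ} (i : Fin m → Fin r) (t : Fin m → Fˣ) : GL (Fin (r + 1)) F :=
  (List.ofFn fun k => xNeg (i k) (t k)).prod

/-- `(0 -1; 1 0)`. -/
def sBar (F : Type*) [DivisionRing F] : GL (Fin 2) F where
  val := !![0, -1; 1, 0]
  inv := !![0, 1; -1, 0]
  val_inv := by simp [Matrix.one_fin_two]
  inv_val := by simp [Matrix.one_fin_two]

/-! ### Double Bruhat cells -/

/-- The double Bruhat cell `G^{u,v} = B u B ∩ B⁻ v B⁻`. -/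
def bruhatCell (F : Type*) [DivisionRing F] {n : ℕ} (u v : Equiv.Perm (Fin n)) :
    Set (GL (Fin n) F) :=
  {g | (∃ b ∈ upperB F n, ∃ b' ∈ upperB F n, g = b * permGL u * b') ∧
    ∃ c ∈ lowerB F n, ∃ c' ∈ lowerB F n, g = c * permGL v * c'}

/-- The reduced double Bruhat cell `L^{u,v} = U ū U ∩ B⁻ v B⁻`. -/
def reducedCell (F : Type*) [DivisionRing F] {n : ℕ} (u v : Equiv.Perm (Fin n)) :
    Set (GL (Fin n) F) :=
  {g | (∃ b ∈ upperU F n, ∃ b' ∈ upperU F n, g = b * permLift u * b') ∧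
    ∃ c ∈ lowerB F n, ∃ c' ∈ lowerB F n, g = c * permGL v * c'}

/-! ### Gauss decomposition and the twist -/

/-- `g = p q` with `p ∈ B⁻` and `q ∈ U`. -/
def IsGauss {n : ℕ} (g p q : GL (Fin n) F) : Prop :=
  p ∈ lowerB F n ∧ q ∈ upperU F n ∧ g = p * q

/-- The Gauss cell `G_0 = B⁻ U`. -/
def gaussCell (F : Type*) [DivisionRing F] (n : ℕ) : Set (GL (Fin n) F) :=
  {g | ∃ p q, IsGauss g p q}

open Classical in
/-- The component `[g]_- ∈ B⁻` of the decomposition `g = [g]_- [g]_+` of `g ∈ G_0` (`1` for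
`g ∉ G_0`). -/
noncomputable def gaussMinus {n : ℕ} (g : GL (Fin n) F) : GL (Fin n) F :=
  if h : g ∈ gaussCell F n then h.choose else 1

open Classical in
/-- The component `[g]_+ ∈ U` of the decomposition `g = [g]_- [g]_+` of `g ∈ G_0` (`1` for
`g ∉ G_0`). -/
noncomputable def gaussPlus {n : ℕ} (g : GL (Fin n) F) : GL (Fin n) F :=
  if h : g ∈ gaussCell F n then h.choose_spec.choose else 1

/-- The positive inverse `x^ι = J x⁻¹ J`, where `J = diag(-1, 1, -1, …, (-1)^n)`. -/
def iota {n : ℕ} (x : GL (Fin n) F) : GL (Fin n) F :=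
  diagGL (fun a => (-1) ^ (a.val + 1)) * x⁻¹ * diagGL (fun a => (-1) ^ (a.val + 1))

/-- The formula for the twist `ψ^{u,v}` on the reduced double Bruhat cell `L^{u,v}`:
`ψ^{u,v}(x) = ([x (v⁻¹)‾]_-)^ι (x^ι)⁻¹ ([ū⁻¹ x]_+)^ι`. -/
noncomputable def reducedTwist {n : ℕ} (u v : Equiv.Perm (Fin n)) (x : GL (Fin n) F) :
    GL (Fin n) F :=
  iota (gaussMinus (x * permLift v⁻¹)) * (iota x)⁻¹ * iota (gaussPlus ((permLift u)⁻¹ * x))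

open Classical in
/-- The twist `ψ^{u,v}` on `G^{u,v} = H L^{u,v}`: the left `H`-equivariant extension
`ψ^{u,v}(h x) = h ψ^{u,v}(x)`, for `h ∈ H` and `x ∈ L^{u,v}`, of the twist on `L^{u,v}` (`1`
outside `H L^{u,v}`). -/
noncomputable def twist {n : ℕ} (u v : Equiv.Perm (Fin n)) (g : GL (Fin n) F) : GL (Fin n) F :=
  if hg : ∃ p : (Fin n → Fˣ) × GL (Fin n) F, p.2 ∈ reducedCell F u v ∧ g = diagGL p.1 * p.2 then
    diagGL hg.choose.1 * reducedTwist u v hg.choose.2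
  else 1

/-! ### The representatives `ū` are the ones determined by the simple reflections -/

theorem permGL_mul {n : ℕ} (u v : Equiv.Perm (Fin n)) :
    (permGL (u * v) : GL (Fin n) F) = permGL u * permGL v := by
  ext a b
  rw [Units.val_mul, Matrix.mul_apply, Finset.sum_eq_single (v b)]
  · simp [permGL]
    rfl
  · intro c _ hc
    simp [permGL, hc]
  · simp

theorem permLift_apply {n : ℕ} (u : Equiv.Perm (Fin n)) (a b : Fin n) :
    (permLift u : GL (Fin n) F).val a b = if a = u b then (colSign F u b : F) else 0 := by
  simp [permLift, permGL, diagGL, Matrix.mul_diagonal]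

theorem permLift_simpleRefl {r : ℕ} (i : Fin r) :
    (permLift (simpleRefl i) : GL (Fin (r + 1)) F) = phi i (sBar F) := by
  have hlt : i.castSucc < i.succ := Fin.castSucc_lt_succ
  have h : i.castSucc ≠ i.succ := hlt.ne
  have sgn : ∀ b, (colSign F (simpleRefl i) b : F) = if b = i.succ then -1 else 1 := by
    intro b
    by_cases hb : b = i.succ
    · have : (Finset.univ.filter fun a : Fin (r + 1) =>
          a < b ∧ simpleRefl i b < simpleRefl i a) = {i.castSucc} := by
        subst hb
        ext a
        simp only [Finset.mem_filter, Finset.mem_univ, true_and, Finset.mem_singleton]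
        constructor
        · rintro ⟨h1, h2⟩
          by_contra ha
          rw [simpleRefl, Equiv.swap_apply_right, Equiv.swap_apply_of_ne_of_ne ha h1.ne] at h2
          simp only [Fin.lt_def, Fin.val_succ, Fin.val_castSucc] at h1 h2
          omega
        · rintro rfl
          simp [simpleRefl]
      rw [colSign, this]
      simp [hb]
    · have : (Finset.univ.filter fun a : Fin (r + 1) =>
          a < b ∧ simpleRefl i b < simpleRefl i a) = ∅ := by
        rw [Finset.filter_eq_empty_iff]
        rintro a - ⟨h1, h2⟩
        simp only [simpleRefl, Equiv.swap_apply_def, hb, if_false] at h2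
        simp only [Fin.lt_def, Fin.ext_iff, Fin.val_succ, Fin.val_castSucc] at *
        split_ifs at h2 <;> simp_all <;> omega
      rw [colSign, this]
      simp [hb]
  ext a b
  rw [permLift_apply, sgn]
  change _ = blockMat i (sBar F).val a b
  by_cases hb : b = i.succ
  · subst hb
    simp only [simpleRefl, Equiv.swap_apply_right, if_true]
    by_cases ha : a = i.succ
    · subst ha
      simp [blockMat, blockInc, blockPos, Matrix.mul_apply, sBar, h.symm, h]
    · by_cases ha' : a = i.castSucc
      · subst ha'
        simp [blockMat, blockInc, blockPos, Matrix.mul_apply, sBar, h.symm, h]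
      · simp [blockMat, blockInc, blockPos, Matrix.mul_apply, sBar, h, ha, ha',
          Matrix.one_apply]
  · by_cases hb' : b = i.castSucc
    · subst hb'
      simp only [simpleRefl, Equiv.swap_apply_left, hb, if_false]
      by_cases ha : a = i.succ
      · subst ha
        simp [blockMat, blockInc, blockPos, Matrix.mul_apply, sBar, h.symm, h]
      · by_cases ha' : a = i.castSucc
        · subst ha'
          simp [blockMat, blockInc, blockPos, Matrix.mul_apply, sBar, h]
        · simp [blockMat, blockInc, blockPos, Matrix.mul_apply, sBar, ha, ha',
            Matrix.one_apply]
    · rw [simpleRefl, Equiv.swap_apply_of_ne_of_ne hb' hb]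
      simp [blockMat, blockInc, blockPos, Matrix.mul_apply, hb, hb', Matrix.one_apply]

theorem no_cancel_of_invNum_add {n : ℕ} (u v : Equiv.Perm (Fin n))
    (h : invNum (u * v) = invNum u + invNum v) (a b : Fin n) (hab : a < b) (hv : v b < v a) :
    u (v b) < u (v a) := by
  classical
  set K := Finset.univ.filter fun p : Fin n × Fin n =>
    p.1 < p.2 ∧ v p.1 < v p.2 ∧ u (v p.2) < u (v p.1) with hK
  set L := Finset.univ.filter fun p : Fin n × Fin n =>
    p.1 < p.2 ∧ v p.2 < v p.1 ∧ u (v p.2) < u (v p.1) with hL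
  set M := Finset.univ.filter fun p : Fin n × Fin n =>
    p.1 < p.2 ∧ v p.2 < v p.1 ∧ u (v p.1) < u (v p.2) with hM
  have tri : ∀ (w : Equiv.Perm (Fin n)) (a b : Fin n), a < b → w a < w b ∨ w b < w a :=
    fun w a b hab => lt_or_gt_of_ne fun e => hab.ne (w.injective e)
  have h1 : invNum (u * v) ≤ K.card + L.card := by
    rw [invNum]
    refine (Finset.card_le_card ?_).trans (Finset.card_union_le K L)
    rintro ⟨a, b⟩ hp
    simp only [Finset.mem_filter, Finset.mem_univ, true_and, hK, hL, Finset.mem_union] at hp ⊢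
    rw [Equiv.Perm.mul_apply, Equiv.Perm.mul_apply] at hp
    rcases tri v a b hp.1 with h' | h'
    · exact Or.inl ⟨hp.1, h', hp.2⟩
    · exact Or.inr ⟨hp.1, h', hp.2⟩
  have h2 : L.card + M.card ≤ invNum v := by
    rw [invNum, ← Finset.card_union_of_disjoint]
    · refine Finset.card_le_card ?_
      rintro ⟨a, b⟩ hp
      simp only [Finset.mem_filter, Finset.mem_univ, true_and, hM, hL, Finset.mem_union] at hp ⊢
      rcases hp with hp | hp <;> exact ⟨hp.1, hp.2.1⟩
    · rw [Finset.disjoint_left]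
      rintro ⟨a, b⟩ hp hp'
      simp only [Finset.mem_filter, Finset.mem_univ, true_and, hM, hL] at hp hp'
      exact lt_asymm hp.2.2 hp'.2.2
  have h3 : K.card ≤ invNum u := by
    rw [invNum]
    refine Finset.card_le_card_of_injOn (fun p => (v p.1, v p.2)) ?_ ?_
    · rintro ⟨a, b⟩ hp
      simp only [hK, Finset.coe_filter, Finset.mem_univ, true_and, Set.mem_ofPred_eq] at hp ⊢
      exact hp.2
    · rintro ⟨a, b⟩ - ⟨c, d⟩ - e
      simpa using e
  have hM0 : M = ∅ := by
    rw [← Finset.card_eq_zero]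
    omega
  rcases tri u (v b) (v a) hv with h' | h'
  · exact h'
  · exfalso
    have : (a, b) ∈ M := by simp [hM, hab, hv, h']
    simp [hM0] at this

theorem colSign_mul {n : ℕ} (u v : Equiv.Perm (Fin n))
    (h : invNum (u * v) = invNum u + invNum v) (j : Fin n) :
    colSign F (u * v) j = colSign F u (v j) * colSign F v j := by
  classical
  have nc := no_cancel_of_invNum_add u v h
  have e : (Finset.univ.filter fun a : Fin n => a < j ∧ (u * v) j < (u * v) a) =
      (Finset.univ.filter fun c : Fin n => c < v j ∧ u (v j) < u c).map v.symm.toEmbedding ∪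
        Finset.univ.filter fun a : Fin n => a < j ∧ v j < v a := by
    ext a
    simp only [Finset.mem_filter, Finset.mem_univ, true_and, Finset.mem_union, Finset.mem_map_equiv,
      Equiv.symm_symm]
    rw [Equiv.Perm.mul_apply, Equiv.Perm.mul_apply]
    constructor
    · rintro ⟨h1, h2⟩
      rcases lt_or_gt_of_ne (fun e => h1.ne (v.injective e) : v a ≠ v j) with h' | h'
      · exact Or.inl ⟨h', h2⟩
      · exact Or.inr ⟨h1, h'⟩
    · rintro (⟨h1, h2⟩ | ⟨h1, h2⟩)
      · refine ⟨?_, h2⟩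
        rcases lt_trichotomy a j with h' | h' | h'
        · exact h'
        · subst h'; exact absurd h1 (lt_irrefl _)
        · exact absurd (nc j a h' h1) (lt_asymm h2)
      · exact ⟨h1, nc a j h1 h2⟩
  rw [colSign, e, Finset.card_union_of_disjoint, Finset.card_map, pow_add, colSign, colSign]
  rw [Finset.disjoint_left]
  intro a ha ha'
  simp only [Finset.mem_filter, Finset.mem_univ, true_and, Finset.mem_map_equiv,
    Equiv.symm_symm] at ha ha'
  exact lt_asymm ha.1 ha'.2

theorem permLift_mul {n : ℕ} (u v : Equiv.Perm (Fin n))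
    (h : invNum (u * v) = invNum u + invNum v) :
    (permLift (u * v) : GL (Fin n) F) = permLift u * permLift v := by
  ext a b
  rw [Units.val_mul, Matrix.mul_apply, Finset.sum_eq_single (v b)]
  · rw [permLift_apply, permLift_apply, permLift_apply, colSign_mul u v h]
    simp
    rfl
  · intro c _ hc
    simp [permLift_apply, hc]
  · simp

end Group

end NCTwist

open NCTwist

/-!
The proof rests on three facts, each valid over a skew field.

*Quasiminors are Gauss diagonal entries.* If `ū⁻¹ x v̄ = p q` with `p ∈ B⁻`, `q ∈ U`, then all
`Δ^k_{u,v}(x)` are defined and equal to `p_{kk}` (`Delta_of_isGauss`): the `k`-th column of `q⁻¹`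
solves the linear system in the definition of the quasideterminant, and the signs are those of the
entries of `ū` and `v̄`. Hence each parameter formula only needs the diagonal of one lower
triangular matrix.

*A rank one step.* If `p ∈ B⁻`, then for a suitable `c` the matrix `p' = x_i(t) p s̄_i x_i(c)` lies
again in `B⁻`, and `p'_{ii} = t p_{i+1,i+1}`, `p'_{i+1,i+1} = t⁻¹ p_{ii}`
(`exists_xPos_mul_lowerB`). If `q ∈ U`, then for a suitable `c` the matrix
`s̄_i⁻¹ x_i(c) q x_{-i}(t)` lies again in `U` (`exists_mul_xNeg_upperU`). Iterating along the word
gives `x₀ ρ ∈ B⁻` in the positive case and `ρ x₀ ∈ U` in the negative case, where `ρ` is a product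
of alternating factors `s̄_i^{±1}` and `x_i(c)` (`IsTwistedProd`).

*Sorting the product.* For a reduced word, the factors `x_i(c)` of such a `ρ` can be moved to the
left, where they become lower unitriangular, or to the right, where they become upper unitriangular
(`IsTwistedProd.exists_lowerU`, `IsTwistedProd.exists_upperU`). Moving them to one side gives the
Gauss decomposition of `x₀ \overline{w⁻¹}` or `w̄⁻¹ x₀`; moving them to the other side gives the
Bruhat cell of `x₀`.

In the positive case write `x₀ = X₁ X₂` for a prefix `u` of the word, and let `p₂ = X₂ ρ₂ ∈ B⁻`.
Sorting the remaining factors shows that `[x₀ \overline{w⁻¹}]_- = X₁ p₂ a \overline{u⁻¹}` with `a`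
lower unitriangular, so that `ū⁻¹ ι([x₀ \overline{w⁻¹}]_-) = ι(a) ι(p₂) ι(X₁)` is a Gauss
decomposition with the diagonal entries `(p₂)_{kk}⁻¹`. The rank one step between consecutive
prefixes then yields the formulas for `t_k` (`listPos_parameter`). In the negative case the same
argument, for a suffix `X₂` of the product, gives the diagonal of `ι(X₂)`, which is known explicitly
(`listNeg_Delta`, `listNeg_parameter`).
-/

namespace NCTwist

/-! ### Triangular matrices -/

section Triangular

variable {F : Type*} [DivisionRing F] {n : ℕ}

/-- A one-sided inverse of a lower triangular matrix over a skew field is lower triangular, and its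
diagonal entries are inverse to those of the matrix. The index set `ιᵒᵈ` gives the same for upper
triangular matrices; the hypothesis `p * q = 1` is spelled out so that it can be transported
there. -/
theorem lowerTriangular_of_mul_eq_one {ι : Type*} [Fintype ι] [LinearOrder ι]
    {p q : ι → ι → F} (hp : ∀ a b, a < b → p a b = 0) (h1 : ∀ a, ∑ c, p a c * q c a = 1)
    (h0 : ∀ a b, a ≠ b → ∑ c, p a c * q c b = 0) (a : ι) :
    p a a * q a a = 1 ∧ ∀ b, a < b → q a b = 0 := by
  induction a using WellFoundedLT.induction with
  | _ a ih =>
    have key : ∀ b, a ≤ b → p a a * q a b = ∑ c, p a c * q c b := by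
      intro b hb
      rw [Finset.sum_eq_single a]
      · intro c _ hc
        rcases lt_or_gt_of_ne hc with hc | hc
        · rw [(ih c hc).2 b (hc.trans_le hb), mul_zero]
        · rw [hp a c hc, zero_mul]
      · simp
    have h2 : p a a * q a a = 1 := by rw [key a le_rfl, h1]
    refine ⟨h2, fun b hb => ?_⟩
    have h3 := (key b hb.le).trans (h0 a b hb.ne)
    exact (mul_eq_zero.mp h3).resolve_left fun e => by simp [e] at h2

theorem GL_mul_inv_sum (g : GL (Fin n) F) (a b : Fin n) :
    ∑ c, g.val a c * g⁻¹.val c b = if a = b then 1 else 0 := by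
  rw [← Matrix.mul_apply, ← Units.val_mul, mul_inv_cancel]
  by_cases hab : a = b <;> simp [hab]

theorem lowerB_inv_aux {g : GL (Fin n) F} (hg : g ∈ lowerB F n) (a : Fin n) :
    g.val a a * g⁻¹.val a a = 1 ∧ ∀ b, a < b → g⁻¹.val a b = 0 :=
  lowerTriangular_of_mul_eq_one hg (fun a => by simp [GL_mul_inv_sum])
    (fun a b hab => by simp [GL_mul_inv_sum, hab]) a

theorem upperB_inv_aux {g : GL (Fin n) F} (hg : g ∈ upperB F n) (a : Fin n) :
    g.val a a * g⁻¹.val a a = 1 ∧ ∀ b, b < a → g⁻¹.val a b = 0 :=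
  lowerTriangular_of_mul_eq_one (ι := (Fin n)ᵒᵈ) (p := g.val) (q := g⁻¹.val)
    (fun a b hab => hg a b hab) (fun a => (GL_mul_inv_sum g a a).trans (if_pos rfl))
    (fun a b hab => (GL_mul_inv_sum g a b).trans (if_neg hab)) a

theorem lowerB_inv {g : GL (Fin n) F} (hg : g ∈ lowerB F n) : g⁻¹ ∈ lowerB F n :=
  fun a b hab => (lowerB_inv_aux hg a).2 b hab

theorem lowerB_inv_diag {g : GL (Fin n) F} (hg : g ∈ lowerB F n) (a : Fin n) :
    g⁻¹.val a a = (g.val a a)⁻¹ :=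
  eq_inv_of_mul_eq_one_right (lowerB_inv_aux hg a).1

theorem lowerB_diag_ne_zero {g : GL (Fin n) F} (hg : g ∈ lowerB F n) (a : Fin n) :
    g.val a a ≠ 0 :=
  left_ne_zero_of_mul_eq_one (lowerB_inv_aux hg a).1

theorem upperB_inv {g : GL (Fin n) F} (hg : g ∈ upperB F n) : g⁻¹ ∈ upperB F n :=
  fun a b hab => (upperB_inv_aux hg a).2 b hab

theorem lowerB_mul_diag {g k : GL (Fin n) F} (hg : g ∈ lowerB F n) (hk : k ∈ lowerB F n)
    (a : Fin n) : (g * k).val a a = g.val a a * k.val a a := by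
  rw [Units.val_mul, Matrix.mul_apply, Finset.sum_eq_single a]
  · intro c _ hc
    rcases lt_or_gt_of_ne hc with hc | hc
    · rw [hk c a hc, mul_zero]
    · rw [hg a c hc, zero_mul]
  · simp

theorem lowerB_mul {g k : GL (Fin n) F} (hg : g ∈ lowerB F n) (hk : k ∈ lowerB F n) :
    g * k ∈ lowerB F n := by
  intro a b hab
  rw [Units.val_mul, Matrix.mul_apply]
  refine Finset.sum_eq_zero fun c _ => ?_
  rcases lt_or_ge a c with hc | hc
  · rw [hg a c hc, zero_mul]
  · rw [hk c b (hc.trans_lt hab), mul_zero]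

theorem upperB_mul_diag {g k : GL (Fin n) F} (hg : g ∈ upperB F n) (hk : k ∈ upperB F n)
    (a : Fin n) : (g * k).val a a = g.val a a * k.val a a := by
  rw [Units.val_mul, Matrix.mul_apply, Finset.sum_eq_single a]
  · intro c _ hc
    rcases lt_or_gt_of_ne hc with hc | hc
    · rw [hg a c hc, zero_mul]
    · rw [hk c a hc, mul_zero]
  · simp

theorem upperB_mul {g k : GL (Fin n) F} (hg : g ∈ upperB F n) (hk : k ∈ upperB F n) :
    g * k ∈ upperB F n := by
  intro a b hab
  rw [Units.val_mul, Matrix.mul_apply]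
  refine Finset.sum_eq_zero fun c _ => ?_
  rcases lt_or_ge b c with hc | hc
  · rw [hk c b hc, mul_zero]
  · rw [hg a c (hc.trans_lt hab), zero_mul]

theorem upperU_mul {g k : GL (Fin n) F} (hg : g ∈ upperU F n) (hk : k ∈ upperU F n) :
    g * k ∈ upperU F n :=
  ⟨upperB_mul hg.1 hk.1, fun a => by rw [upperB_mul_diag hg.1 hk.1, hg.2, hk.2, one_mul]⟩

theorem upperU_inv {g : GL (Fin n) F} (hg : g ∈ upperU F n) : g⁻¹ ∈ upperU F n :=
  ⟨upperB_inv hg.1, fun a => by simpa [hg.2 a] using (upperB_inv_aux hg.1 a).1⟩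

theorem one_mem_upperU : (1 : GL (Fin n) F) ∈ upperU F n :=
  ⟨fun _ _ hab => Matrix.one_apply_ne hab.ne', fun _ => Matrix.one_apply_eq _⟩

theorem one_mem_lowerB : (1 : GL (Fin n) F) ∈ lowerB F n :=
  fun _ _ hab => Matrix.one_apply_ne hab.ne

/-- The subgroup of lower unitriangular matrices. -/
def lowerU (F : Type*) [DivisionRing F] (n : ℕ) : Set (GL (Fin n) F) :=
  {g | g ∈ lowerB F n ∧ ∀ a : Fin n, g.val a a = 1}

theorem one_mem_lowerU : (1 : GL (Fin n) F) ∈ lowerU F n :=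
  ⟨one_mem_lowerB, fun _ => Matrix.one_apply_eq _⟩

theorem lowerU_mul {g k : GL (Fin n) F} (hg : g ∈ lowerU F n) (hk : k ∈ lowerU F n) :
    g * k ∈ lowerU F n :=
  ⟨lowerB_mul hg.1 hk.1, fun a => by rw [lowerB_mul_diag hg.1 hk.1, hg.2, hk.2, one_mul]⟩

theorem lowerU_inv {g : GL (Fin n) F} (hg : g ∈ lowerU F n) : g⁻¹ ∈ lowerU F n :=
  ⟨lowerB_inv hg.1, fun a => by rw [lowerB_inv_diag hg.1, hg.2, inv_one]⟩

/-! ### Diagonal and monomial matrices -/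

theorem diagGL_mul_apply (h : Fin n → Fˣ) (g : GL (Fin n) F) (a b : Fin n) :
    (diagGL h * g).val a b = h a * g.val a b := by
  simp [diagGL, Units.val_mul, Matrix.diagonal_mul]

theorem mul_diagGL_apply (h : Fin n → Fˣ) (g : GL (Fin n) F) (a b : Fin n) :
    (g * diagGL h).val a b = g.val a b * h b := by
  simp [diagGL, Units.val_mul, Matrix.mul_diagonal]

theorem diagGL_apply (h : Fin n → Fˣ) (a b : Fin n) :
    (diagGL h).val a b = if a = b then (h a : F) else 0 := by
  simp [diagGL, Matrix.diagonal_apply]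

theorem diagGL_inv (h : Fin n → Fˣ) : (diagGL h)⁻¹ = diagGL fun a => (h a)⁻¹ := by
  refine inv_eq_of_mul_eq_one_right (Units.ext (Matrix.ext fun a b => ?_))
  rw [diagGL_mul_apply, diagGL_apply]
  by_cases hab : a = b <;> simp [hab]

theorem diagGL_mem_lowerB (h : Fin n → Fˣ) : diagGL h ∈ lowerB F n :=
  fun a b hab => by simp [diagGL_apply, hab.ne]

theorem diagGL_mem_upperB (h : Fin n → Fˣ) : diagGL h ∈ upperB F n :=
  fun a b hab => by simp [diagGL_apply, hab.ne']

theorem diagGL_diag (h : Fin n → Fˣ) (a : Fin n) : (diagGL h).val a a = h a := by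
  simp [diagGL_apply]

theorem permGL_one : (permGL 1 : GL (Fin n) F) = 1 := by
  ext a b
  by_cases hab : a = b <;> simp [permGL, hab]

theorem permGL_inv (u : Equiv.Perm (Fin n)) : (permGL u : GL (Fin n) F)⁻¹ = permGL u⁻¹ := by
  refine inv_eq_of_mul_eq_one_right ?_
  rw [← permGL_mul, mul_inv_cancel, permGL_one]

theorem permGL_mul_apply (u : Equiv.Perm (Fin n)) (g : GL (Fin n) F) (a b : Fin n) :
    (permGL u * g).val (u a) b = g.val a b := by
  rw [Units.val_mul, Matrix.mul_apply, Finset.sum_eq_single a]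
  · simp [permGL]
  · intro c _ hc
    simp [permGL, hc.symm]
  · simp

theorem mul_permGL_apply (u : Equiv.Perm (Fin n)) (g : GL (Fin n) F) (a b : Fin n) :
    (g * permGL u).val a b = g.val a (u b) := by
  rw [Units.val_mul, Matrix.mul_apply, Finset.sum_eq_single (u b)]
  · simp [permGL]
  · intro c _ hc
    simp [permGL, hc]
  · simp

/-- `g` is a monomial matrix that represents the permutation `v`. -/
def IsMonomial (v : Equiv.Perm (Fin n)) (g : GL (Fin n) F) : Prop :=
  ∃ d : Fin n → Fˣ, g = permGL v * diagGL d

theorem diagGL_mul_permGL (v : Equiv.Perm (Fin n)) (d : Fin n → Fˣ) :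
    diagGL d * permGL v = permGL v * diagGL fun a => d (v a) := by
  ext a b
  rw [mul_permGL_apply, mul_diagGL_apply, diagGL_apply]
  by_cases hab : a = v b <;> simp [permGL, hab]

theorem isMonomial_one : IsMonomial 1 (1 : GL (Fin n) F) :=
  ⟨fun _ => 1, by ext a b; rw [mul_diagGL_apply, permGL_one]; simp⟩

theorem IsMonomial.mul {u v : Equiv.Perm (Fin n)} {g k : GL (Fin n) F} (hg : IsMonomial u g)
    (hk : IsMonomial v k) : IsMonomial (u * v) (g * k) := by
  obtain ⟨d, rfl⟩ := hg
  obtain ⟨e, rfl⟩ := hk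
  refine ⟨fun a => d (v a) * e a, ?_⟩
  rw [permGL_mul, mul_assoc, ← mul_assoc (diagGL d), diagGL_mul_permGL]
  simp only [mul_assoc]
  congr 2
  ext a b
  rw [diagGL_mul_apply, diagGL_apply, diagGL_apply]
  by_cases hab : a = b <;> simp [hab]

theorem IsMonomial.inv {u : Equiv.Perm (Fin n)} {g : GL (Fin n) F} (hg : IsMonomial u g) :
    IsMonomial u⁻¹ g⁻¹ := by
  obtain ⟨d, rfl⟩ := hg
  rw [mul_inv_rev, permGL_inv, diagGL_inv, diagGL_mul_permGL]
  exact ⟨_, rfl⟩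

theorem IsMonomial.conj_apply {v : Equiv.Perm (Fin n)} {g : GL (Fin n) F} (hg : IsMonomial v g)
    (x : GL (Fin n) F) : ∃ d : Fin n → Fˣ, ∀ a b : Fin n,
      (g * x * g⁻¹).val (v a) (v b) = d a * x.val a b * (d b)⁻¹ := by
  obtain ⟨d, rfl⟩ := hg
  refine ⟨d, fun a b => ?_⟩
  rw [mul_inv_rev, permGL_inv, diagGL_inv, ← mul_assoc, mul_permGL_apply, mul_assoc, mul_assoc,
    permGL_mul_apply, diagGL_mul_apply, mul_diagGL_apply]
  simp [mul_assoc]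

theorem IsMonomial.conj_mem_upperU {v : Equiv.Perm (Fin n)} {g : GL (Fin n) F}
    (hg : IsMonomial v g) {x : GL (Fin n) F} (hx : ∀ a, x.val a a = 1)
    (h : ∀ a b, v b < v a → x.val a b = 0) : g * x * g⁻¹ ∈ upperU F n := by
  obtain ⟨d, hd⟩ := hg.conj_apply x
  refine ⟨fun a b hab => ?_, fun a => ?_⟩
  · obtain ⟨a, rfl⟩ := v.surjective a
    obtain ⟨b, rfl⟩ := v.surjective b
    simp [hd, h a b hab]
  · obtain ⟨a, rfl⟩ := v.surjective a
    simp [hd, hx]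

theorem IsMonomial.conj_mem_lowerU {v : Equiv.Perm (Fin n)} {g : GL (Fin n) F}
    (hg : IsMonomial v g) {x : GL (Fin n) F} (hx : ∀ a, x.val a a = 1)
    (h : ∀ a b, v a < v b → x.val a b = 0) : g * x * g⁻¹ ∈ lowerU F n := by
  obtain ⟨d, hd⟩ := hg.conj_apply x
  refine ⟨fun a b hab => ?_, fun a => ?_⟩
  · obtain ⟨a, rfl⟩ := v.surjective a
    obtain ⟨b, rfl⟩ := v.surjective b
    simp [hd, h a b hab]
  · obtain ⟨a, rfl⟩ := v.surjective a
    simp [hd, hx]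

theorem isMonomial_permLift (u : Equiv.Perm (Fin n)) :
    IsMonomial u (permLift u : GL (Fin n) F) :=
  ⟨_, rfl⟩

theorem colSign_inv (u : Equiv.Perm (Fin n)) (a : Fin n) : (colSign F u a)⁻¹ = colSign F u a := by
  rw [colSign, ← inv_pow]
  simp

theorem permLift_inv_mul_mul_apply (u v : Equiv.Perm (Fin n)) (x : GL (Fin n) F) (a b : Fin n) :
    ((permLift u)⁻¹ * x * permLift v).val a b =
      colSign F u a * x.val (u a) (v b) * colSign F v b := by
  have : ∀ (u : Equiv.Perm (Fin n)) (g : GL (Fin n) F) (a b : Fin n),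
      ((permGL u)⁻¹ * g).val a b = g.val (u a) b := by
    intro u g a b
    rw [← permGL_mul_apply u, mul_inv_cancel_left]
  rw [permLift, permLift, ← mul_assoc, mul_diagGL_apply, mul_permGL_apply, mul_inv_rev, mul_assoc,
    diagGL_inv, diagGL_mul_apply, this, colSign_inv]

theorem colSign_one (b : Fin n) : colSign F 1 b = 1 := by
  have : (Finset.univ.filter fun a : Fin n => a < b ∧ (1 : Equiv.Perm (Fin n)) b <
      (1 : Equiv.Perm (Fin n)) a) = ∅ := by
    rw [Finset.filter_eq_empty_iff]
    rintro a - ⟨h1, h2⟩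
    exact lt_asymm h1 h2
  rw [colSign, this, Finset.card_empty, pow_zero]

theorem permLift_one : (permLift 1 : GL (Fin n) F) = 1 := by
  ext a b
  rw [permLift_apply, colSign_one]
  by_cases hab : a = b <;> simp [hab]

theorem permLift_inv_mul_diagGL (u : Equiv.Perm (Fin n)) (h : Fin n → Fˣ) :
    (permLift u : GL (Fin n) F)⁻¹ * diagGL h = diagGL (fun a => h (u a)) * (permLift u)⁻¹ := by
  -- the signs `colSign` are central
  rw [eq_mul_inv_iff_mul_eq, mul_assoc, inv_mul_eq_iff_eq_mul]
  ext a b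
  rw [diagGL_mul_apply, mul_diagGL_apply, permLift_apply]
  by_cases hab : a = u b
  · subst hab
    simp only [if_true, colSign]
    push_cast
    exact ((Commute.neg_one_left _).pow_left _).symm
  · simp [hab]

end Triangular

/-! ### Positive quasiminors and the Gauss decomposition -/

section Quasiminors

variable {F : Type*} [DivisionRing F] {n : ℕ}

/-- The leading block of `x`, on the rows and columns before `k`. -/
def leadingBlock (k : Fin n) (x : Matrix (Fin n) (Fin n) F) :
    Matrix {a : Fin n // a < k} {a : Fin n // a < k} F :=
  x.submatrix Subtype.val Subtype.val

theorem sum_lt_subtype (k : Fin n) (f : Fin n → F) (hf : ∀ c, k ≤ c → f c = 0) :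
    ∑ c : {a : Fin n // a < k}, f c = ∑ c, f c := by
  rw [← Finset.sum_subtype (Finset.Iio k) (fun _ => Finset.mem_Iio) f]
  exact Finset.sum_subset (Finset.subset_univ _) fun c _ hc => hf c (by simpa using hc)

theorem sum_eq_sum_lt_add (k : Fin n) (f : Fin n → F) (hf : ∀ c, k < c → f c = 0) :
    ∑ c, f c = ∑ c : {a : Fin n // a < k}, f c + f k := by
  rw [← Finset.sum_subtype (Finset.Iio k) (fun _ => Finset.mem_Iio) f, add_comm,
    ← Finset.sum_insert (by simp), Finset.Iio_insert]
  exact (Finset.sum_subset (Finset.subset_univ _) fun c _ hc => hf c (by simpa using hc)).symm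

theorem leadingBlock_lower_mul (k : Fin n) {p : GL (Fin n) F} (hp : p ∈ lowerB F n)
    (x : Matrix (Fin n) (Fin n) F) :
    leadingBlock k (p.val * x) = leadingBlock k p.val * leadingBlock k x := by
  ext a b
  rw [Matrix.mul_apply]
  exact (sum_lt_subtype k (fun c => p.val a c * x c b) fun c hc => by
    rw [hp a c (a.2.trans_le hc), zero_mul]).symm

theorem leadingBlock_mul_upper (k : Fin n) {q : GL (Fin n) F} (hq : q ∈ upperB F n)
    (x : Matrix (Fin n) (Fin n) F) :
    leadingBlock k (x * q.val) = leadingBlock k x * leadingBlock k q.val := by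
  ext a b
  rw [Matrix.mul_apply]
  exact (sum_lt_subtype k (fun c => x a c * q.val c b) fun c hc => by
    rw [hq c b (b.2.trans_le hc), mul_zero]).symm

theorem leadingBlock_one (k : Fin n) : leadingBlock k (1 : Matrix (Fin n) (Fin n) F) = 1 :=
  Matrix.submatrix_one _ Subtype.val_injective

theorem isUnit_leadingBlock_lower (k : Fin n) {p : GL (Fin n) F} (hp : p ∈ lowerB F n) :
    IsUnit (leadingBlock k p.val) := by
  refine ⟨⟨leadingBlock k p.val, leadingBlock k p⁻¹.val, ?_, ?_⟩, rfl⟩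
  · rw [← leadingBlock_lower_mul k hp, ← Units.val_mul, mul_inv_cancel]
    exact leadingBlock_one k
  · rw [← leadingBlock_lower_mul k (lowerB_inv hp), ← Units.val_mul, inv_mul_cancel]
    exact leadingBlock_one k

theorem isUnit_leadingBlock_upper (k : Fin n) {q : GL (Fin n) F} (hq : q ∈ upperB F n) :
    IsUnit (leadingBlock k q.val) := by
  refine ⟨⟨leadingBlock k q.val, leadingBlock k q⁻¹.val, ?_, ?_⟩, rfl⟩
  · rw [← leadingBlock_mul_upper k (upperB_inv hq), ← Units.val_mul, mul_inv_cancel]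
    exact leadingBlock_one k
  · rw [← leadingBlock_mul_upper k hq, ← Units.val_mul, inv_mul_cancel]
    exact leadingBlock_one k

theorem isUnit_diagonal {ι : Type*} [Fintype ι] [DecidableEq ι] (d : ι → Fˣ) :
    IsUnit (Matrix.diagonal fun a => (d a : F)) :=
  ⟨⟨Matrix.diagonal fun a => (d a : F), Matrix.diagonal fun a => ((d a)⁻¹ : Fˣ), by simp [Matrix.diagonal_mul_diagonal],
    by simp [Matrix.diagonal_mul_diagonal]⟩, rfl⟩

/-- The part of `imageInit u k` that is left when its last element is removed is indexed by the
positions before `k`. -/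
def initEquiv (u : Equiv.Perm (Fin n)) (k : Fin n) :
    {p : imageInit u k // p ≠ lastOf u k} ≃ {a : Fin n // a < k} where
  toFun p := ⟨u.symm p.1.1, by
    obtain ⟨⟨p, hp⟩, hne⟩ := p
    obtain ⟨a, ha, rfl⟩ := Finset.mem_map.mp hp
    refine lt_of_le_of_ne (by simpa using ha) ?_
    intro e
    exact hne (Subtype.ext (by simp [lastOf, ← e]))⟩
  invFun a := ⟨⟨u a, Finset.mem_map_of_mem u.toEmbedding (Finset.mem_Iic.mpr a.2.le)⟩, fun e =>
    a.2.ne (u.injective (congrArg Subtype.val e))⟩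
  left_inv p := Subtype.ext (Subtype.ext (by simp))
  right_inv a := Subtype.ext (by simp)

/-- A quasideterminant can be computed from a solution `y` of the linear system with the matrix
`A^{ij}`. -/
theorem quasidet_eq_of_solution {R ι κ : Type*} [Ring R] [Fintype ι] [Fintype κ] [DecidableEq ι]
    [DecidableEq κ] {A : Matrix ι κ R} {i : ι} {j : κ} (hA : QuasidetDefined A i j)
    (y : {q : κ // q ≠ j} → R)
    (hy : ∀ p : {p : ι // p ≠ i}, A p j = ∑ q : {q : κ // q ≠ j}, A p q * y q) :
    quasidet A i j = A i j - ∑ q : {q : κ // q ≠ j}, A i q * y q := by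
  obtain ⟨B, hB⟩ := hA
  rw [quasidet, hB.matInv_eq]
  congr 1
  refine Finset.sum_congr rfl fun q _ => ?_
  have h1 : Matrix.mulVec B (fun p : {p : ι // p ≠ i} => A p j) = y := by
    have : (fun p : {p : ι // p ≠ i} => A p j) = Matrix.mulVec (deleteRowCol A i j) y :=
      funext hy
    rw [this, Matrix.mulVec_mulVec, hB.2, Matrix.one_mulVec]
  rw [← h1, Matrix.mulVec, dotProduct, Finset.mul_sum]
  simp only [mul_assoc]

theorem numGreater_imageInit (u : Equiv.Perm (Fin n)) (k : Fin n) :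
    (-1 : F) ^ numGreater (imageInit u k) (u k) = colSign F u k := by
  have : (imageInit u k).filter (fun a => u k < a) =
      (Finset.univ.filter fun a : Fin n => a < k ∧ u k < u a).map u.toEmbedding := by
    ext c
    obtain ⟨a, rfl⟩ := u.surjective c
    simp only [imageInit, Finset.mem_filter, Finset.mem_map_equiv, Equiv.symm_apply_apply,
      Finset.mem_Iic, Finset.mem_univ, true_and]
    exact and_congr_left fun h => ⟨fun h' => lt_of_le_of_ne h' (by rintro rfl; simp at h), le_of_lt⟩
  rw [numGreater, this, Finset.card_map, colSign]
  push_cast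
  rfl

theorem colSign_mul_self (u : Equiv.Perm (Fin n)) (a : Fin n) :
    (colSign F u a : F) * colSign F u a = 1 := by
  rw [← Units.val_mul, mul_eq_one_iff_eq_inv.mpr (colSign_inv u a).symm, Units.val_one]

theorem colSign_comm (u : Equiv.Perm (Fin n)) (a : Fin n) (c : F) :
    Commute (colSign F u a : F) c := by
  simp only [colSign]
  push_cast
  exact (Commute.neg_one_left _).pow_left _

/-- The positive quasiminors `Δ^k_{u,v}(x)` are the diagonal entries of the lower triangular factor
in the Gauss decomposition of `ū⁻¹ x v̄`. The signs in the definition of the positive quasiminor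
are the signs of the entries of `ū` and `v̄`. -/
theorem Delta_of_isGauss {u v : Equiv.Perm (Fin n)} {x p q : GL (Fin n) F}
    (hg : IsGauss ((permLift u)⁻¹ * x * permLift v) p q) (k : Fin n) :
    DeltaDefined k u v x.val ∧ Delta k u v x.val = p.val k k := by
  obtain ⟨hp, hq, hM⟩ := hg
  have hx : ∀ a b, x.val (u a) (v b) = colSign F u a * (p * q).val a b * colSign F v b := by
    intro a b
    rw [← hM, permLift_inv_mul_mul_apply]
    calc _ = (colSign F u a * colSign F u a : F) * x.val (u a) (v b) *
          (colSign F v b * colSign F v b : F) := by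
            rw [colSign_mul_self, colSign_mul_self, one_mul, mul_one]
      _ = _ := by simp only [mul_assoc]
  set N : Matrix {a : Fin n // a < k} {a : Fin n // a < k} F :=
    leadingBlock k (x.val.submatrix u v) with hN
  have hNu : IsUnit N := by
    have : N = Matrix.diagonal (fun a : {a : Fin n // a < k} => (colSign F u a : F)) *
        (leadingBlock k p.val * leadingBlock k q.val) *
        Matrix.diagonal fun a : {a : Fin n // a < k} => (colSign F v a : F) := by
      ext a b
      rw [← leadingBlock_lower_mul k hp, Matrix.mul_diagonal, Matrix.diagonal_mul]
      exact hx a b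
    rw [this]
    exact ((isUnit_diagonal _).mul ((isUnit_leadingBlock_lower k hp).mul
      (isUnit_leadingBlock_upper k hq.1))).mul (isUnit_diagonal _)
  have hdef : DeltaDefined k u v x.val := by
    obtain ⟨N', hN'⟩ := hNu
    have hD : deleteRowCol (subMat x.val (imageInit u k) (imageInit v k)) (lastOf u k)
        (lastOf v k) = N.submatrix (initEquiv u k) (initEquiv v k) := by
      ext a b
      simp [hN, leadingBlock, deleteRowCol, subMat, initEquiv]
    refine ⟨N'⁻¹.val.submatrix (initEquiv v k) (initEquiv u k), ?_, ?_⟩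
    · rw [hD, Matrix.submatrix_mul_equiv, ← hN', ← Units.val_mul, mul_inv_cancel, Units.val_one,
        Matrix.submatrix_one_equiv]
    · rw [hD, Matrix.submatrix_mul_equiv, ← hN', ← Units.val_mul, inv_mul_cancel, Units.val_one,
        Matrix.submatrix_one_equiv]
  refine ⟨hdef, ?_⟩
  -- the column `k` of `(p q) q⁻¹ = p` solves the linear system
  set Y : Fin n → F := fun b => colSign F v b * q⁻¹.val b k * colSign F v k with hY
  have hq' := upperU_inv hq
  have hsum : ∀ a, x.val (u a) (v k) = colSign F u a * p.val a k * colSign F v k -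
      ∑ b : {b : Fin n // b < k}, x.val (u a) (v b) * Y b := by
    intro a
    have h1 := sum_eq_sum_lt_add k (fun b => x.val (u a) (v b) * Y b) fun c hc => by
      simp [hY, hq'.1 c k hc]
    have h2 : ∑ b, x.val (u a) (v b) * Y b = colSign F u a * p.val a k * colSign F v k := by
      calc _ = ∑ b, colSign F u a * ((p * q).val a b * q⁻¹.val b k) * colSign F v k := by
            refine Finset.sum_congr rfl fun b _ => ?_
            rw [hx, hY]
            calc _ = colSign F u a * (p * q).val a b * (colSign F v b * colSign F v b) *
                  q⁻¹.val b k * colSign F v k := by simp only [mul_assoc]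
              _ = _ := by rw [colSign_mul_self]; simp only [mul_assoc, one_mul]
        _ = _ := by
            rw [← Finset.sum_mul, ← Finset.mul_sum, ← Matrix.mul_apply, ← Units.val_mul,
              mul_inv_cancel_right]
    have h3 : Y k = 1 := by rw [hY]; simp only [hq'.2, mul_one, colSign_mul_self]
    rw [h2] at h1
    rw [h1, h3, mul_one, add_sub_cancel_left]
  have hre : ∀ a, ∑ c : {c : imageInit v k // c ≠ lastOf v k},
      x.val (u a) c.1.1 * -Y (initEquiv v k c) =
        -∑ b : {b : Fin n // b < k}, x.val (u a) (v b) * Y b := by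
    intro a
    rw [← Equiv.sum_comp (initEquiv v k), ← Finset.sum_neg_distrib]
    exact Finset.sum_congr rfl fun c _ => by simp [initEquiv]
  have hqd := quasidet_eq_of_solution hdef (fun c => -Y (initEquiv v k c)) (by
    intro c
    obtain ⟨a, rfl⟩ := (initEquiv u k).symm.surjective c
    refine (hsum a).trans ?_
    rw [hp a k a.2, mul_zero, zero_mul, zero_sub]
    exact (hre a).symm)
  have hqd' : quasidet (subMat x.val (imageInit u k) (imageInit v k)) (lastOf u k) (lastOf v k) =
      colSign F u k * p.val k k * colSign F v k := by
    refine hqd.trans (sub_eq_iff_eq_add.mpr ?_)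
    refine (hsum k).trans ?_
    rw [sub_eq_add_neg]
    exact congrArg _ (hre k).symm
  rw [Delta, posQuasiminor, hqd', pow_add]
  change (-1 : F) ^ numGreater (imageInit u k) (u k) * (-1 : F) ^ numGreater (imageInit v k) (v k) *
    _ = _
  rw [numGreater_imageInit, numGreater_imageInit, ← (colSign_comm v k (_ * _)).eq,
    mul_assoc, ← mul_assoc (colSign F v k : F), colSign_mul_self, one_mul, ← mul_assoc,
    colSign_mul_self, one_mul]

end Quasiminors

/-! ### Uniqueness of the Gauss decomposition -/

section Gauss

variable {F : Type*} [DivisionRing F] {n : ℕ}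

theorem eq_one_of_lowerB_of_upperU {g : GL (Fin n) F} (h1 : g ∈ lowerB F n)
    (h2 : g ∈ upperU F n) : g = 1 := by
  ext a b
  rcases lt_trichotomy a b with h | rfl | h
  · rw [h1 a b h, Units.val_one, Matrix.one_apply_ne h.ne]
  · rw [h2.2, Units.val_one, Matrix.one_apply_eq]
  · rw [h2.1 a b h, Units.val_one, Matrix.one_apply_ne h.ne']

theorem IsGauss.unique {g p q p' q' : GL (Fin n) F} (h : IsGauss g p q) (h' : IsGauss g p' q') :
    p = p' ∧ q = q' := by
  have e : p'⁻¹ * p = q' * q⁻¹ := by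
    rw [inv_mul_eq_iff_eq_mul, ← mul_assoc, eq_mul_inv_iff_mul_eq, ← h.2.2, ← h'.2.2]
  have h1 : p'⁻¹ * p = 1 := eq_one_of_lowerB_of_upperU (lowerB_mul (lowerB_inv h'.1) h.1)
    (e ▸ upperU_mul h'.2.1 (upperU_inv h.2.1))
  have hp : p = p' := (inv_mul_eq_one.mp h1).symm
  refine ⟨hp, ?_⟩
  have := h.2.2.symm.trans h'.2.2
  rw [hp] at this
  exact mul_left_cancel this

theorem isGauss_choose {g : GL (Fin n) F} (h : g ∈ gaussCell F n) :
    IsGauss g (gaussMinus g) (gaussPlus g) := by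
  rw [gaussMinus, gaussPlus, dif_pos h, dif_pos h]
  exact h.choose_spec.choose_spec

theorem IsGauss.gaussMinus_eq {g p q : GL (Fin n) F} (h : IsGauss g p q) : gaussMinus g = p :=
  ((isGauss_choose ⟨p, q, h⟩).unique h).1

theorem IsGauss.gaussPlus_eq {g p q : GL (Fin n) F} (h : IsGauss g p q) : gaussPlus g = q :=
  ((isGauss_choose ⟨p, q, h⟩).unique h).2

/-! ### The positive inverse -/

/-- The entries of `x^ι` are those of `x⁻¹` up to a checkerboard of signs. -/
theorem iota_apply (x : GL (Fin n) F) (a b : Fin n) :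
    (iota x).val a b = (-1) ^ (a.val + b.val) * x⁻¹.val a b := by
  rw [iota, mul_diagGL_apply, diagGL_mul_apply]
  push_cast
  rw [mul_assoc, ← ((Commute.neg_one_left _).pow_left _).eq, ← mul_assoc, ← pow_add,
    show a.val + 1 + (b.val + 1) = a.val + b.val + 2 by ring, pow_add _ _ 2]
  simp

theorem iota_mul (x y : GL (Fin n) F) : iota (x * y) = iota y * iota x := by
  have h : (diagGL (fun a : Fin n => (-1) ^ (a.val + 1)) : GL (Fin n) F) *
      diagGL (fun a => (-1) ^ (a.val + 1)) = 1 := by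
    nth_rw 1 [← inv_mul_cancel (diagGL (fun a : Fin n => (-1) ^ (a.val + 1)) : GL (Fin n) F)]
    rw [diagGL_inv]
    simp [← inv_pow]
  simp only [iota, mul_inv_rev]
  calc _ = diagGL (fun a => (-1) ^ (a.val + 1)) * y⁻¹ * 1 * x⁻¹ *
        diagGL (fun a => (-1) ^ (a.val + 1)) := by simp only [mul_assoc, mul_one]
    _ = _ := by rw [← h]; simp only [mul_assoc]

theorem iota_inv (x : GL (Fin n) F) : iota x⁻¹ = (iota x)⁻¹ := by
  refine eq_inv_of_mul_eq_one_left ?_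
  rw [← iota_mul, mul_inv_cancel]
  ext a b
  by_cases hab : a = b <;> simp [iota_apply, hab]

theorem iota_mem_lowerB {x : GL (Fin n) F} (hx : x ∈ lowerB F n) : iota x ∈ lowerB F n :=
  fun a b hab => by rw [iota_apply, lowerB_inv hx a b hab, mul_zero]

theorem iota_lowerB_diag {x : GL (Fin n) F} (hx : x ∈ lowerB F n) (a : Fin n) :
    (iota x).val a a = (x.val a a)⁻¹ := by
  rw [iota_apply, lowerB_inv_diag hx, ← two_mul, pow_mul]
  simp

theorem iota_mem_upperU {x : GL (Fin n) F} (hx : x ∈ upperU F n) : iota x ∈ upperU F n := by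
  refine ⟨fun a b hab => ?_, fun a => ?_⟩
  · rw [iota_apply, upperB_inv hx.1 a b hab, mul_zero]
  · rw [iota_apply, (upperU_inv hx).2, ← two_mul, pow_mul]
    simp

/-- The number of inversions of `v` with lower position `a`, minus those with upper position `a`, is
`v a - a`. -/
theorem card_inversions_add (v : Equiv.Perm (Fin n)) (a : Fin n) :
    (Finset.univ.filter fun c : Fin n => a < c ∧ v c < v a).card + a.val =
      (Finset.univ.filter fun c : Fin n => c < a ∧ v a < v c).card + (v a).val := by
  set X := Finset.univ.filter fun c : Fin n => c < a ∧ v c < v a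
  have h1 : (Finset.univ.filter fun c : Fin n => c < a ∧ v a < v c).card + X.card = a.val := by
    rw [← Fin.card_Iio a, ← Finset.card_union_of_disjoint]
    · congr 1
      ext c
      have := fun h : v c = v a => v.injective h
      simp only [X, Finset.mem_union, Finset.mem_filter, Finset.mem_univ, true_and, Finset.mem_Iio]
      grind
    · rw [Finset.disjoint_left]
      simp only [X, Finset.mem_filter]
      grind
  have h2 : (Finset.univ.filter fun c : Fin n => a < c ∧ v c < v a).card + X.card = (v a).val := by
    rw [← Fin.card_Iio (v a), ← Finset.card_union_of_disjoint,
      ← Finset.card_map v.toEmbedding]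
    · congr 1
      ext c
      obtain ⟨c, rfl⟩ := v.surjective c
      have := fun h : v c = v a => v.injective h
      simp only [X, Finset.mem_union, Finset.mem_filter, Finset.mem_univ, true_and, Finset.mem_Iio,
        Finset.mem_map_equiv, Equiv.symm_apply_apply]
      grind
    · rw [Finset.disjoint_left]
      simp only [X, Finset.mem_filter]
      grind
  omega

/-- The positive inverse exchanges the representatives of `u` and `u⁻¹`: the signs agree by the
parity of `card_inversions_add`. -/
theorem iota_permLift_inv (u : Equiv.Perm (Fin n)) :
    iota (permLift u⁻¹ : GL (Fin n) F) = permLift u := by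
  have hinv : ∀ (v : Equiv.Perm (Fin n)) (a b : Fin n),
      ((permLift v : GL (Fin n) F)⁻¹).val a b = if v a = b then (colSign F v a : F) else 0 := by
    intro v a b
    have := permLift_inv_mul_mul_apply (F := F) v 1 1 a b
    rw [permLift_one, mul_one, mul_one] at this
    rw [this]
    by_cases h : v a = b <;> simp [h, colSign_one]
  ext a b
  rw [iota_apply, hinv, permLift_apply]
  by_cases h : a = u b
  · subst h
    rw [show u⁻¹ (u b) = b from u.symm_apply_apply b, if_pos rfl, if_pos rfl]
    have e : (Finset.univ.filter fun c : Fin n => c < u b ∧ u⁻¹ (u b) < u⁻¹ c).card =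
        (Finset.univ.filter fun c : Fin n => b < c ∧ u c < u b).card := by
      rw [← Finset.card_map u.symm.toEmbedding]
      congr 1
      ext c
      simp [Finset.mem_map_equiv, and_comm]
    have hc := card_inversions_add u b
    simp only [colSign]
    rw [e]
    push_cast
    rw [← pow_add, neg_one_pow_congr (R := F)]
    grind
  · have h' : ¬ u⁻¹ a = b := fun e => h (by rw [← e]; exact (u.apply_symm_apply a).symm)
    rw [if_neg h, if_neg h', mul_zero]

end Gauss

/-! ### Reduced words -/

section Reduced

variable {r : ℕ}

/-- The list `l` of letters is a reduced word (for its product). -/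
def IsReducedList (l : List (Fin r)) : Prop :=
  invNum (l.map simpleRefl).prod = l.length

theorem invNum_mul_le {n : ℕ} (u v : Equiv.Perm (Fin n)) :
    invNum (u * v) ≤ invNum u + invNum v := by
  classical
  -- an inversion `(a, b)` of `u v` is an inversion of `v`, or `(v a, v b)` is an inversion of `u`
  set K := Finset.univ.filter fun p : Fin n × Fin n =>
    p.1 < p.2 ∧ v p.1 < v p.2 ∧ u (v p.2) < u (v p.1) with hK
  have h1 : invNum (u * v) ≤ K.card + invNum v := by
    rw [invNum, invNum]
    refine (Finset.card_le_card ?_).trans (Finset.card_union_le K _)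
    rintro ⟨a, b⟩ hp
    simp only [Finset.mem_filter, Finset.mem_univ, true_and, hK, Finset.mem_union] at hp ⊢
    rw [Equiv.Perm.mul_apply, Equiv.Perm.mul_apply] at hp
    rcases lt_or_gt_of_ne fun e => hp.1.ne (v.injective e) with h' | h'
    · exact Or.inl ⟨hp.1, h', hp.2⟩
    · exact Or.inr ⟨hp.1, h'⟩
  have h3 : K.card ≤ invNum u := by
    rw [invNum]
    refine Finset.card_le_card_of_injOn (fun p => (v p.1, v p.2)) ?_ ?_
    · rintro ⟨a, b⟩ hp
      simp only [hK, Finset.coe_filter, Finset.mem_univ, true_and, Set.mem_ofPred_eq] at hp ⊢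
      exact hp.2
    · rintro ⟨a, b⟩ - ⟨c, d⟩ - e
      simpa using e
  omega

theorem invNum_simpleRefl_le (i : Fin r) : invNum (simpleRefl i) ≤ 1 := by
  rw [invNum, Finset.card_le_one]
  have key : ∀ p : Fin (r + 1) × Fin (r + 1), p.1 < p.2 →
      simpleRefl i p.2 < simpleRefl i p.1 → p = (i.castSucc, i.succ) := by
    rintro ⟨a, b⟩ h1 h2
    simp only [simpleRefl, Equiv.swap_apply_def] at h1 h2
    simp only [Fin.lt_def, Fin.ext_iff, Fin.val_succ, Fin.val_castSucc, Prod.mk.injEq] at *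
    split_ifs at h2 <;> simp_all <;> omega
  intro p hp q hq
  simp only [Finset.mem_filter, Finset.mem_univ, true_and] at hp hq
  rw [key p hp.1 hp.2, key q hq.1 hq.2]

theorem invNum_prod_le (l : List (Fin r)) : invNum (l.map simpleRefl).prod ≤ l.length := by
  induction l with
  | nil =>
    rw [List.map_nil, List.prod_nil, invNum, Finset.filter_eq_empty_iff.mpr]
    · simp
    · rintro p - ⟨h1, h2⟩
      exact lt_asymm h1 h2
  | cons i l ih =>
    rw [List.map_cons, List.prod_cons, List.length_cons]
    have := invNum_mul_le (simpleRefl i) (l.map simpleRefl).prod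
    have := invNum_simpleRefl_le i
    omega

theorem IsReducedList.append {l l' : List (Fin r)} (h : IsReducedList (l ++ l')) :
    IsReducedList l ∧ IsReducedList l' ∧
      invNum ((l.map simpleRefl).prod * (l'.map simpleRefl).prod) =
        invNum (l.map simpleRefl).prod + invNum (l'.map simpleRefl).prod := by
  unfold IsReducedList at *
  rw [List.map_append, List.prod_append, List.length_append] at h
  have := invNum_mul_le (l.map simpleRefl).prod (l'.map simpleRefl).prod
  have := invNum_prod_le l
  have := invNum_prod_le l'
  omega

theorem simpleRefl_castSucc (i : Fin r) : simpleRefl i i.castSucc = i.succ :=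
  Equiv.swap_apply_left _ _

theorem simpleRefl_succ (i : Fin r) : simpleRefl i i.succ = i.castSucc :=
  Equiv.swap_apply_right _ _

theorem simpleRefl_inv (i : Fin r) : (simpleRefl i)⁻¹ = simpleRefl i :=
  Equiv.swap_inv _ _

/-- If `l, i` is a reduced word, then the product of `l` sends the simple root of `i` to a positive
root. -/
theorem IsReducedList.lt_of_snoc {l : List (Fin r)} {i : Fin r} (h : IsReducedList (l ++ [i])) :
    (l.map simpleRefl).prod i.castSucc < (l.map simpleRefl).prod i.succ := by
  have := no_cancel_of_invNum_add (l.map simpleRefl).prod (simpleRefl i)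
    (by simpa using h.append.2.2) i.castSucc i.succ Fin.castSucc_lt_succ
    (by rw [simpleRefl_castSucc, simpleRefl_succ]; exact Fin.castSucc_lt_succ)
  rwa [simpleRefl_castSucc, simpleRefl_succ] at this

theorem IsReducedList.lt_of_cons {l : List (Fin r)} {i : Fin r} (h : IsReducedList (i :: l)) :
    (l.map simpleRefl).prod⁻¹ i.castSucc < (l.map simpleRefl).prod⁻¹ i.succ := by
  set v := (l.map simpleRefl).prod with hv
  have key := no_cancel_of_invNum_add (simpleRefl i) v
    (by simpa using IsReducedList.append (l := [i]) h |>.2.2)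
  have hs : ∀ a, v (v⁻¹ a) = a := fun a => v.apply_symm_apply a
  refine lt_of_not_ge fun hle => ?_
  have hlt : v⁻¹ i.succ < v⁻¹ i.castSucc := lt_of_le_of_ne hle fun e =>
    Fin.castSucc_lt_succ.ne' (v⁻¹.injective e)
  have := key _ _ hlt (by rw [hs, hs]; exact Fin.castSucc_lt_succ)
  rw [hs, hs, simpleRefl_castSucc, simpleRefl_succ] at this
  exact lt_asymm this Fin.castSucc_lt_succ

variable {F : Type*} [DivisionRing F]

theorem permLift_list_prod {l : List (Fin r)} (h : IsReducedList l) :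
    (permLift (l.map simpleRefl).prod : GL (Fin (r + 1)) F) =
      (l.map fun i => permLift (simpleRefl i)).prod := by
  induction l with
  | nil => simp [permLift_one]
  | cons i l ih =>
    have h' := IsReducedList.append (l := [i]) h
    simp only [List.map_cons, List.prod_cons]
    rw [← ih h'.2.1, permLift_mul _ _ (by simpa using h'.2.2)]

theorem iota_permLift_simpleRefl (i : Fin r) :
    iota (permLift (simpleRefl i) : GL (Fin (r + 1)) F) = permLift (simpleRefl i) := by
  conv_lhs => rw [← simpleRefl_inv i]
  exact iota_permLift_inv _

theorem iota_one {n : ℕ} : iota (1 : GL (Fin n) F) = 1 := by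
  have := iota_mul (1 : GL (Fin n) F) 1
  rw [mul_one] at this
  exact left_eq_mul.mp this

theorem iota_list_prod {n : ℕ} (L : List (GL (Fin n) F)) :
    iota L.prod = (L.map iota).reverse.prod := by
  induction L with
  | nil => simp [iota_one]
  | cons a L ih => simp [iota_mul, ih]

theorem permLift_list_prod_inv {l : List (Fin r)} (h : IsReducedList l) :
    (permLift (l.map simpleRefl).prod⁻¹ : GL (Fin (r + 1)) F) =
      (l.map fun i => permLift (simpleRefl i)).reverse.prod := by
  have h1 := iota_permLift_inv (F := F) (l.map simpleRefl).prod⁻¹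
  rw [inv_inv] at h1
  rw [← h1, permLift_list_prod h, iota_list_prod, List.map_map]
  congr 2
  exact List.map_congr_left fun i _ => iota_permLift_simpleRefl i

end Reduced

/-! ### Elementary factors -/

section Elementary

variable {F : Type*} [DivisionRing F] {r : ℕ}

theorem phi_mul_castSucc (i : Fin r) (M : GL (Fin 2) F) (g : GL (Fin (r + 1)) F) (b) :
    (phi i M * g).val i.castSucc b =
      M.val 0 0 * g.val i.castSucc b + M.val 0 1 * g.val i.succ b := by
  have h : i.castSucc ≠ i.succ := Fin.castSucc_lt_succ.ne
  rw [Units.val_mul, Matrix.mul_apply, Finset.sum_eq_add _ _ h]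
  · rw [← phi_apply_block i M 0 0, ← phi_apply_block i M 0 1]
    rfl
  · intro c _ hc
    rw [phi_apply_right i M _ c hc, if_neg hc.1.symm, zero_mul]
  · simp
  · simp

theorem phi_mul_succ (i : Fin r) (M : GL (Fin 2) F) (g : GL (Fin (r + 1)) F) (b) :
    (phi i M * g).val i.succ b =
      M.val 1 0 * g.val i.castSucc b + M.val 1 1 * g.val i.succ b := by
  have h : i.castSucc ≠ i.succ := Fin.castSucc_lt_succ.ne
  rw [Units.val_mul, Matrix.mul_apply, Finset.sum_eq_add _ _ h]
  · rw [← phi_apply_block i M 1 0, ← phi_apply_block i M 1 1]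
    rfl
  · intro c _ hc
    rw [phi_apply_right i M _ c hc, if_neg hc.2.symm, zero_mul]
  · simp
  · simp

theorem phi_mul_of_ne (i : Fin r) (M : GL (Fin 2) F) (g : GL (Fin (r + 1)) F) {a}
    (ha : a ≠ i.castSucc ∧ a ≠ i.succ) (b) : (phi i M * g).val a b = g.val a b := by
  rw [Units.val_mul, Matrix.mul_apply, Finset.sum_eq_single a]
  · rw [phi_apply_left i M a a ha, if_pos rfl, one_mul]
  · intro c _ hc
    rw [phi_apply_left i M a c ha, if_neg hc.symm, zero_mul]
  · simp

theorem mul_phi_castSucc (i : Fin r) (M : GL (Fin 2) F) (g : GL (Fin (r + 1)) F) (a) :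
    (g * phi i M).val a i.castSucc =
      g.val a i.castSucc * M.val 0 0 + g.val a i.succ * M.val 1 0 := by
  have h : i.castSucc ≠ i.succ := Fin.castSucc_lt_succ.ne
  rw [Units.val_mul, Matrix.mul_apply, Finset.sum_eq_add _ _ h]
  · rw [← phi_apply_block i M 0 0, ← phi_apply_block i M 1 0]
    rfl
  · intro c _ hc
    rw [phi_apply_left i M c _ hc, if_neg hc.1, mul_zero]
  · simp
  · simp

theorem mul_phi_succ (i : Fin r) (M : GL (Fin 2) F) (g : GL (Fin (r + 1)) F) (a) :
    (g * phi i M).val a i.succ =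
      g.val a i.castSucc * M.val 0 1 + g.val a i.succ * M.val 1 1 := by
  have h : i.castSucc ≠ i.succ := Fin.castSucc_lt_succ.ne
  rw [Units.val_mul, Matrix.mul_apply, Finset.sum_eq_add _ _ h]
  · rw [← phi_apply_block i M 0 1, ← phi_apply_block i M 1 1]
    rfl
  · intro c _ hc
    rw [phi_apply_left i M c _ hc, if_neg hc.2, mul_zero]
  · simp
  · simp

theorem mul_phi_of_ne (i : Fin r) (M : GL (Fin 2) F) (g : GL (Fin (r + 1)) F) (a) {b}
    (hb : b ≠ i.castSucc ∧ b ≠ i.succ) : (g * phi i M).val a b = g.val a b := by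
  rw [Units.val_mul, Matrix.mul_apply, Finset.sum_eq_single b]
  · rw [phi_apply_right i M b b hb, if_pos rfl, mul_one]
  · intro c _ hc
    rw [phi_apply_right i M c b hb, if_neg hc, mul_zero]
  · simp

theorem xPos_apply (i : Fin r) (c : F) (a b : Fin (r + 1)) :
    (xPos i c).val a b =
      if a = b then 1 else if a = i.castSucc ∧ b = i.succ then c else 0 := by
  have h : i.castSucc ≠ i.succ := Fin.castSucc_lt_succ.ne
  have h1 := mul_phi_of_ne i
    { val := !![1, c; 0, 1], inv := !![1, -c; 0, 1], val_inv := by simp [Matrix.one_fin_two],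
      inv_val := by simp [Matrix.one_fin_two] } (1 : GL (Fin (r + 1)) F) a (b := b)
  have h2 := mul_phi_castSucc i
    { val := !![1, c; 0, 1], inv := !![1, -c; 0, 1], val_inv := by simp [Matrix.one_fin_two],
      inv_val := by simp [Matrix.one_fin_two] } (1 : GL (Fin (r + 1)) F) a
  have h3 := mul_phi_succ i
    { val := !![1, c; 0, 1], inv := !![1, -c; 0, 1], val_inv := by simp [Matrix.one_fin_two],
      inv_val := by simp [Matrix.one_fin_two] } (1 : GL (Fin (r + 1)) F) a
  rw [one_mul] at h1 h2 h3
  rw [xPos]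
  by_cases hb : b = i.castSucc
  · subst hb
    rw [h2]
    by_cases ha : a = i.castSucc <;> simp [ha, h]
  · by_cases hb' : b = i.succ
    · subst hb'
      rw [h3]
      by_cases ha : a = i.castSucc
      · subst ha
        simp [h]
      · by_cases ha' : a = i.succ <;> simp [ha, ha', h.symm]
    · rw [h1 ⟨hb, hb'⟩]
      by_cases ha : a = b <;> simp [ha, hb']

theorem xPos_mem_upperU (i : Fin r) (c : F) : xPos i c ∈ upperU F (r + 1) := by
  refine ⟨fun a b hab => ?_, fun a => by simp [xPos_apply]⟩
  rw [xPos_apply, if_neg hab.ne', if_neg]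
  rintro ⟨rfl, rfl⟩
  exact lt_asymm hab Fin.castSucc_lt_succ

theorem xNeg_mem_lowerB (i : Fin r) (t : Fˣ) : xNeg i t ∈ lowerB F (r + 1) := by
  intro a b hab
  rw [xNeg, ← mul_one (phi i _)]
  by_cases ha : a = i.castSucc
  · subst ha
    rw [phi_mul_castSucc]
    simp [hab.ne]
  · by_cases ha' : a = i.succ
    · subst ha'
      rw [phi_mul_succ]
      have := (Fin.castSucc_lt_succ (i := i)).trans hab
      simp [hab.ne, this.ne]
    · rw [phi_mul_of_ne i _ _ ⟨ha, ha'⟩]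
      simp [hab.ne]

theorem xNeg_castSucc (i : Fin r) (t : Fˣ) :
    (xNeg i t).val i.castSucc i.castSucc = ((t⁻¹ : Fˣ) : F) :=
  phi_apply_block i _ 0 0

theorem xNeg_succ (i : Fin r) (t : Fˣ) : (xNeg i t).val i.succ i.succ = (t : F) :=
  phi_apply_block i _ 1 1

/-- The rank one step for the positive factorization: in the rows and columns `i`, `i + 1`, if
`p` has the diagonal entries `a`, `d`, then the new diagonal entries are `t d`, `t⁻¹ a`. The
parameter `c` is chosen so that the entry at `(i, i + 1)` vanishes. -/
theorem exists_xPos_mul_lowerB (i : Fin r) (t : Fˣ) {p : GL (Fin (r + 1)) F}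
    (hp : p ∈ lowerB F (r + 1)) : ∃ c : F,
      xPos i (t : F) * p * (permLift (simpleRefl i) * xPos i c) ∈ lowerB F (r + 1) ∧
      (xPos i (t : F) * p * (permLift (simpleRefl i) * xPos i c)).val i.castSucc i.castSucc =
        t * p.val i.succ i.succ ∧
      (xPos i (t : F) * p * (permLift (simpleRefl i) * xPos i c)).val i.succ i.succ =
        (t : F)⁻¹ * p.val i.castSucc i.castSucc := by
  have hlt : i.castSucc < i.succ := Fin.castSucc_lt_succ
  have hd := lowerB_diag_ne_zero hp i.succ
  have h0 := hp _ _ hlt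
  set g := xPos i (t : F) * p with hg
  have g1 : ∀ b, g.val i.castSucc b = p.val i.castSucc b + t * p.val i.succ b := by
    intro b
    rw [hg, xPos, phi_mul_castSucc]
    simp
  have g2 : ∀ a b, a ≠ i.castSucc → g.val a b = p.val a b := by
    intro a b ha
    by_cases ha' : a = i.succ
    · subst ha'
      rw [hg, xPos, phi_mul_succ]
      simp
    · rw [hg, xPos, phi_mul_of_ne i _ _ ⟨ha, ha'⟩]
  set c : F := (t * p.val i.succ i.succ)⁻¹ * (p.val i.castSucc i.castSucc +
    t * p.val i.succ i.castSucc) with hc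
  have ht : (t : F) ≠ 0 := t.ne_zero
  have hc' : (t * p.val i.succ i.succ) * c = p.val i.castSucc i.castSucc +
    t * p.val i.succ i.castSucc := mul_inv_cancel_left₀ (mul_ne_zero ht hd) _
  have hc'' : p.val i.succ i.succ * c = (t : F)⁻¹ * p.val i.castSucc i.castSucc +
      p.val i.succ i.castSucc := by
    have := congrArg (fun z => (t : F)⁻¹ * z) hc'
    simpa [mul_assoc, mul_add, ht] using this
  have k1 : ∀ a, (g * (permLift (simpleRefl i) * xPos i c)).val a i.castSucc =
      g.val a i.succ := by
    intro a
    rw [permLift_simpleRefl, xPos, ← map_mul, mul_phi_castSucc]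
    simp [sBar]
  have k2 : ∀ a, (g * (permLift (simpleRefl i) * xPos i c)).val a i.succ =
      -g.val a i.castSucc + g.val a i.succ * c := by
    intro a
    rw [permLift_simpleRefl, xPos, ← map_mul, mul_phi_succ]
    simp [sBar]
  have k3 : ∀ a b, b ≠ i.castSucc ∧ b ≠ i.succ →
      (g * (permLift (simpleRefl i) * xPos i c)).val a b = g.val a b := by
    intro a b hb
    rw [permLift_simpleRefl, xPos, ← map_mul, mul_phi_of_ne i _ _ _ hb]
  refine ⟨c, fun a b hab => ?_, ?_, ?_⟩
  · by_cases hb : b = i.castSucc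
    · subst hb
      rw [k1, g2 a _ hab.ne, hp _ _ (hab.trans hlt)]
    · by_cases hb' : b = i.succ
      · subst hb'
        rw [k2]
        by_cases ha : a = i.castSucc
        · subst ha
          rw [g1, g1, h0, zero_add, hc', neg_add_cancel]
        · have : a < i.castSucc := by
            simp only [Fin.lt_def, Fin.ext_iff, Fin.val_succ, Fin.val_castSucc] at *
            omega
          rw [g2 a _ ha, g2 a _ ha, hp _ _ this, hp _ _ hab, neg_zero, zero_mul, zero_add]
      · rw [k3 a b ⟨hb, hb'⟩]
        by_cases ha : a = i.castSucc
        · subst ha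
          have : i.succ < b := by
            simp only [Fin.lt_def, Fin.ext_iff, Fin.val_succ, Fin.val_castSucc] at *
            omega
          rw [g1, hp _ _ hab, hp _ _ this, mul_zero, zero_add]
        · rw [g2 a b ha, hp a b hab]
  · rw [k1, g1, h0, zero_add]
  · rw [k2, g2 _ _ hlt.ne', g2 _ _ hlt.ne', hc'']
    abel

/-- The rank one step for the negative factorization. The parameter `c` is chosen so that the entry
at `(i + 1, i)` vanishes. -/
theorem exists_mul_xNeg_upperU (i : Fin r) (t : Fˣ) {q : GL (Fin (r + 1)) F}
    (hq : q ∈ upperU F (r + 1)) : ∃ c : F,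
      (permLift (simpleRefl i))⁻¹ * xPos i c * (q * xNeg i t) ∈ upperU F (r + 1) := by
  have hlt : i.castSucc < i.succ := Fin.castSucc_lt_succ
  set g := q * xNeg i t with hg
  have g1 : ∀ a, g.val a i.castSucc = q.val a i.castSucc * (t : F)⁻¹ + q.val a i.succ := by
    intro a
    rw [hg, xNeg, mul_phi_castSucc]
    simp
  have g2 : ∀ a, g.val a i.succ = q.val a i.succ * t := by
    intro a
    rw [hg, xNeg, mul_phi_succ]
    simp
  have g3 : ∀ a b, b ≠ i.castSucc ∧ b ≠ i.succ → g.val a b = q.val a b := by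
    intro a b hb
    rw [hg, xNeg, mul_phi_of_ne i _ _ _ hb]
  set c : F := -((t : F)⁻¹ + q.val i.castSucc i.succ) with hc
  have k1 : ∀ b, ((permLift (simpleRefl i))⁻¹ * xPos i c * g).val i.castSucc b =
      g.val i.succ b := by
    intro b
    rw [permLift_simpleRefl, xPos, ← map_inv, ← map_mul, phi_mul_castSucc]
    simp [sBar]
  have k2 : ∀ b, ((permLift (simpleRefl i))⁻¹ * xPos i c * g).val i.succ b =
      -g.val i.castSucc b - c * g.val i.succ b := by
    intro b
    rw [permLift_simpleRefl, xPos, ← map_inv, ← map_mul, phi_mul_succ]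
    simp [sBar]
    abel
  have k3 : ∀ a b, a ≠ i.castSucc ∧ a ≠ i.succ →
      ((permLift (simpleRefl i))⁻¹ * xPos i c * g).val a b = g.val a b := by
    intro a b ha
    rw [permLift_simpleRefl, xPos, ← map_inv, ← map_mul, phi_mul_of_ne i _ _ ha]
  have q0 := hq.1 _ _ hlt
  have ht : (t : F) ≠ 0 := t.ne_zero
  have lt_iff : ∀ b, b < i.succ ↔ b = i.castSucc ∨ b < i.castSucc := by
    intro b
    simp only [Fin.lt_def, Fin.ext_iff, Fin.val_succ, Fin.val_castSucc]
    omega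
  refine ⟨c, fun a b hab => ?_, fun a => ?_⟩
  · by_cases ha : a = i.castSucc
    · subst ha
      rw [k1, g3 _ _ ⟨hab.ne, (hab.trans hlt).ne⟩, hq.1 _ _ (hab.trans hlt)]
    · by_cases ha' : a = i.succ
      · subst ha'
        rw [k2]
        rcases (lt_iff b).mp hab with rfl | hb
        · rw [g1, g1, q0, hq.2, hq.2, hc]
          simp
        · rw [g3 _ _ ⟨hb.ne, hab.ne⟩, g3 _ _ ⟨hb.ne, hab.ne⟩, hq.1 _ _ hb, hq.1 _ _ hab]
          simp
      · rw [k3 a b ⟨ha, ha'⟩]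
        by_cases hb : b = i.castSucc
        · subst hb
          have : i.succ < a := lt_of_le_of_ne (not_lt.mp fun h => by
            rcases (lt_iff a).mp h with h | h
            · exact ha h
            · exact lt_asymm h hab) (Ne.symm ha')
          rw [g1, hq.1 _ _ hab, hq.1 _ _ this, zero_mul, zero_add]
        · by_cases hb' : b = i.succ
          · subst hb'
            rw [g2, hq.1 _ _ hab, zero_mul]
          · rw [g3 _ _ ⟨hb, hb'⟩, hq.1 _ _ hab]
  · by_cases ha : a = i.castSucc
    · subst ha
      rw [k1, g1, q0, hq.2, zero_mul, zero_add]
    · by_cases ha' : a = i.succ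
      · subst ha'
        rw [k2, g2, g2, hq.2, hc, one_mul, neg_mul, add_mul, inv_mul_cancel₀ ht]
        abel
      · rw [k3 _ _ ⟨ha, ha'⟩, g3 _ _ ⟨ha, ha'⟩, hq.2]

end Elementary

/-! ### Twisted products along a word -/

section TwistedProducts

variable {F : Type*} [DivisionRing F] {r : ℕ}

/-- `IsTwistedProd ν l ρ` says that `ρ = ν_{i_m} x_{i_m}(c_m) ⋯ ν_{i_1} x_{i_1}(c_1)` for the word
`l = (i_1, …, i_m)` and some `c_1, …, c_m`. Here `ν_i` will be one of the two representatives
`s̄_i`, `s̄_i⁻¹` of the simple reflection `s_i`. -/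
inductive IsTwistedProd (ν : Fin r → GL (Fin (r + 1)) F) :
    List (Fin r) → GL (Fin (r + 1)) F → Prop
  | nil : IsTwistedProd ν [] 1
  | cons {i : Fin r} {l : List (Fin r)} {ρ : GL (Fin (r + 1)) F} (c : F)
      (h : IsTwistedProd ν l ρ) : IsTwistedProd ν (i :: l) (ρ * (ν i * xPos i c))

variable {ν : Fin r → GL (Fin (r + 1)) F}

theorem IsTwistedProd.append {l l' : List (Fin r)} {ρ ρ' : GL (Fin (r + 1)) F}
    (h : IsTwistedProd ν l ρ) (h' : IsTwistedProd ν l' ρ') :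
    IsTwistedProd ν (l ++ l') (ρ' * ρ) := by
  induction h with
  | nil => simpa using h'
  | cons c _ ih =>
    rw [← mul_assoc]
    exact .cons c ih

theorem IsTwistedProd.singleton (i : Fin r) (c : F) : IsTwistedProd ν [i] (ν i * xPos i c) := by
  simpa using IsTwistedProd.cons (ν := ν) c .nil

theorem IsTwistedProd.exists_of_snoc {l : List (Fin r)} {i : Fin r} {ρ : GL (Fin (r + 1)) F}
    (h : IsTwistedProd ν (l ++ [i]) ρ) :
    ∃ c ρ', IsTwistedProd ν l ρ' ∧ ρ = ν i * xPos i c * ρ' := by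
  induction l generalizing ρ with
  | nil =>
    cases h with
    | cons c h =>
      cases h
      exact ⟨c, 1, .nil, by simp⟩
  | cons j l ih =>
    cases h with
    | cons c h =>
      obtain ⟨c', ρ', h', rfl⟩ := ih h
      exact ⟨c', _, .cons c h', by simp only [mul_assoc]⟩

theorem isMonomial_reverse_prod (hν : ∀ i, IsMonomial (simpleRefl i) (ν i)) (l : List (Fin r)) :
    IsMonomial (l.map simpleRefl).prod⁻¹ (l.map ν).reverse.prod := by
  induction l with
  | nil => simpa using isMonomial_one
  | cons i l ih => simpa [simpleRefl_inv] using ih.mul (hν i)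

/-- For a reduced word, the factors `x_i(c)` of a twisted product can be moved to the left, past the
representatives of reflections; they become lower triangular. -/
theorem IsTwistedProd.exists_lowerU (hν : ∀ i, IsMonomial (simpleRefl i) (ν i))
    {l : List (Fin r)} (hl : IsReducedList l) {ρ : GL (Fin (r + 1)) F}
    (h : IsTwistedProd ν l ρ) :
    ∃ a ∈ lowerU F (r + 1), ρ = a * (l.map ν).reverse.prod := by
  induction h with
  | nil => exact ⟨1, one_mem_lowerU, by simp⟩
  | @cons i l ρ c h ih =>
    obtain ⟨a, ha, rfl⟩ := ih (IsReducedList.append (l := [i]) hl).2.1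
    have hm := isMonomial_reverse_prod hν (i :: l)
    set N := ((i :: l).map ν).reverse.prod with hN
    have hN' : N = (l.map ν).reverse.prod * ν i := by simp [hN]
    refine ⟨a * (N * xPos i c * N⁻¹), lowerU_mul ha (hm.conj_mem_lowerU ?_ ?_), ?_⟩
    · exact (xPos_mem_upperU i c).2
    · intro x y hxy
      rw [xPos_apply, if_neg (by rintro rfl; exact lt_irrefl _ hxy), if_neg]
      rintro ⟨rfl, rfl⟩
      have := hl.lt_of_cons
      rw [List.map_cons, List.prod_cons, mul_inv_rev, simpleRefl_inv, Equiv.Perm.mul_apply,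
        Equiv.Perm.mul_apply, simpleRefl_castSucc, simpleRefl_succ] at hxy
      exact lt_asymm hxy this
    · rw [hN']
      group

/-- For a reduced word, the factors `x_i(c)` of a twisted product can be moved to the right, and
they stay upper triangular. -/
theorem IsTwistedProd.exists_upperU (hν : ∀ i, IsMonomial (simpleRefl i) (ν i))
    {l : List (Fin r)} (hl : IsReducedList l) {ρ : GL (Fin (r + 1)) F}
    (h : IsTwistedProd ν l ρ) :
    ∃ b ∈ upperU F (r + 1), ρ = (l.map ν).reverse.prod * b := by
  induction l using List.reverseRecOn generalizing ρ with
  | nil =>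
    cases h
    exact ⟨1, one_mem_upperU, by simp⟩
  | append_singleton l i ih =>
    obtain ⟨c, ρ', h', rfl⟩ := h.exists_of_snoc
    obtain ⟨b, hb, rfl⟩ := ih hl.append.1 h'
    have hm := (isMonomial_reverse_prod hν l).inv
    rw [inv_inv] at hm
    set N := (l.map ν).reverse.prod with hN
    refine ⟨N⁻¹ * xPos i c * N⁻¹⁻¹ * b, upperU_mul (hm.conj_mem_upperU ?_ ?_) hb, ?_⟩
    · exact (xPos_mem_upperU i c).2
    · intro x y hxy
      rw [xPos_apply, if_neg (by rintro rfl; exact lt_irrefl _ hxy), if_neg]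
      rintro ⟨rfl, rfl⟩
      exact lt_asymm hxy hl.lt_of_snoc
    · have : ((l ++ [i]).map ν).reverse.prod = ν i * N := by simp [hN]
      rw [this]
      group

/-- The product `x_{i_1}(t_1) ⋯ x_{i_m}(t_m)` over a list of pairs `(i_k, t_k)`. -/
def listPos (L : List (Fin r × Fˣ)) : GL (Fin (r + 1)) F :=
  (L.map fun z => xPos z.1 (z.2 : F)).prod

/-- The product `x_{-i_1}(t_1) ⋯ x_{-i_m}(t_m)` over a list of pairs `(i_k, t_k)`. -/
def listNeg (L : List (Fin r × Fˣ)) : GL (Fin (r + 1)) F :=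
  (L.map fun z => xNeg z.1 z.2).prod

theorem listPos_mem_upperU (L : List (Fin r × Fˣ)) : listPos L ∈ upperU F (r + 1) := by
  induction L with
  | nil => exact one_mem_upperU
  | cons z L ih => simpa [listPos] using upperU_mul (xPos_mem_upperU z.1 (z.2 : F)) ih

theorem listNeg_mem_lowerB (L : List (Fin r × Fˣ)) : listNeg L ∈ lowerB F (r + 1) := by
  induction L with
  | nil => exact one_mem_lowerB
  | cons z L ih => simpa [listNeg] using lowerB_mul (xNeg_mem_lowerB z.1 z.2) ih

theorem exists_listPos_mul_lowerB (L : List (Fin r × Fˣ)) {p : GL (Fin (r + 1)) F}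
    (hp : p ∈ lowerB F (r + 1)) :
    ∃ ρ, IsTwistedProd (fun i => permLift (simpleRefl i)) (L.map Prod.fst) ρ ∧
      listPos L * p * ρ ∈ lowerB F (r + 1) := by
  induction L with
  | nil => exact ⟨1, .nil, by simpa [listPos] using hp⟩
  | cons z L ih =>
    obtain ⟨ρ, hρ, h⟩ := ih
    obtain ⟨c, hc, -⟩ := exists_xPos_mul_lowerB z.1 z.2 h
    refine ⟨_, hρ.cons c, ?_⟩
    simpa [listPos, mul_assoc] using hc

theorem exists_mul_listNeg_upperU (L : List (Fin r × Fˣ)) {q : GL (Fin (r + 1)) F}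
    (hq : q ∈ upperU F (r + 1)) :
    ∃ ρ, IsTwistedProd (fun i => (permLift (simpleRefl i))⁻¹) (L.map Prod.fst) ρ ∧
      ρ * q * listNeg L ∈ upperU F (r + 1) := by
  induction L generalizing q with
  | nil => exact ⟨1, .nil, by simpa [listNeg] using hq⟩
  | cons z L ih =>
    obtain ⟨c, hc⟩ := exists_mul_xNeg_upperU z.1 z.2 hq
    obtain ⟨ρ, hρ, h⟩ := ih hc
    refine ⟨_, hρ.cons c, ?_⟩
    simpa [listNeg, mul_assoc] using h

theorem isMonomial_permLift_simpleRefl_inv (i : Fin r) :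
    IsMonomial (simpleRefl i) (permLift (simpleRefl i) : GL (Fin (r + 1)) F)⁻¹ := by
  simpa [simpleRefl_inv] using (isMonomial_permLift (F := F) (simpleRefl i)).inv

theorem reverse_prod_inv {l : List (Fin r)} (hl : IsReducedList l) :
    (l.map fun i => (permLift (simpleRefl i) : GL (Fin (r + 1)) F)⁻¹).reverse.prod =
      (permLift (l.map simpleRefl).prod)⁻¹ := by
  rw [permLift_list_prod hl, List.prod_inv_reverse, List.map_map]
  rfl

/-- A twisted product of the `s̄_i` along a reduced word for `w` lies in `U⁻ w⁻¹‾ ∩ w⁻¹‾ U`. -/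
theorem IsTwistedProd.eq_permLift_inv {l : List (Fin r)} (hl : IsReducedList l)
    {ρ : GL (Fin (r + 1)) F} (h : IsTwistedProd (fun i => permLift (simpleRefl i)) l ρ) :
    (∃ a ∈ lowerU F (r + 1), ρ = a * permLift (l.map simpleRefl).prod⁻¹) ∧
      ∃ b ∈ upperU F (r + 1), ρ = permLift (l.map simpleRefl).prod⁻¹ * b := by
  rw [permLift_list_prod_inv hl]
  exact ⟨h.exists_lowerU (fun i => isMonomial_permLift _) hl,
    h.exists_upperU (fun i => isMonomial_permLift _) hl⟩

/-- A twisted product of the `s̄_i⁻¹` along a reduced word for `w` lies in `U⁻ w̄⁻¹ ∩ w̄⁻¹ U`. -/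
theorem IsTwistedProd.eq_inv_permLift {l : List (Fin r)} (hl : IsReducedList l)
    {ρ : GL (Fin (r + 1)) F} (h : IsTwistedProd (fun i => (permLift (simpleRefl i))⁻¹) l ρ) :
    (∃ a ∈ lowerU F (r + 1), ρ = a * (permLift (l.map simpleRefl).prod)⁻¹) ∧
      ∃ b ∈ upperU F (r + 1), ρ = (permLift (l.map simpleRefl).prod)⁻¹ * b := by
  rw [← reverse_prod_inv hl]
  exact ⟨h.exists_lowerU isMonomial_permLift_simpleRefl_inv hl,
    h.exists_upperU isMonomial_permLift_simpleRefl_inv hl⟩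

end TwistedProducts

/-! ### The twist on the reduced double Bruhat cells -/

section Twist

variable {F : Type*} [DivisionRing F]

/-- The decomposition `G^{u,v} = H L^{u,v}` is unique. -/
theorem diagGL_eq_of_mul_eq {n : ℕ} {u v : Equiv.Perm (Fin n)} {h h' : Fin n → Fˣ}
    {x x' : GL (Fin n) F} (hx : x ∈ reducedCell F u v) (hx' : x' ∈ reducedCell F u v)
    (e : diagGL h * x = diagGL h' * x') : h = h' := by
  obtain ⟨⟨b, hb, b', hb', rfl⟩, -⟩ := hx
  obtain ⟨⟨c, hc, c', hc', rfl⟩, -⟩ := hx'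
  have key : permLift u * (c' * b'⁻¹) * (permLift u)⁻¹ =
      c⁻¹ * (diagGL (fun a => (h' a)⁻¹) * diagGL h) * b := by
    rw [← diagGL_inv]
    calc _ = c⁻¹ * (diagGL h')⁻¹ * (diagGL h' * (c * permLift u * c')) * b'⁻¹ *
          (permLift u)⁻¹ := by group
      _ = _ := by rw [← e]; group
  obtain ⟨d, hd⟩ := (isMonomial_permLift u).conj_apply (c' * b'⁻¹)
  funext a
  obtain ⟨a, rfl⟩ := u.surjective a
  have h1 := hd a a
  have hU := upperU_mul hc' (upperU_inv hb')
  have hD : diagGL (fun a => (h' a)⁻¹) * diagGL h ∈ upperB F n :=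
    upperB_mul (diagGL_mem_upperB _) (diagGL_mem_upperB _)
  rw [key, upperB_mul_diag (upperB_mul (upperU_inv hc).1 hD) hb.1,
    upperB_mul_diag (upperU_inv hc).1 hD, hb.2, (upperU_inv hc).2, diagGL_mul_apply, diagGL_diag,
    hU.2, one_mul, mul_one, mul_one, ← Units.val_mul, ← Units.val_mul,
    mul_inv_cancel] at h1
  exact (inv_mul_eq_one.mp (Units.ext h1)).symm

theorem twist_diagGL_mul {n : ℕ} {u v : Equiv.Perm (Fin n)} (h : Fin n → Fˣ)
    {x : GL (Fin n) F} (hx : x ∈ reducedCell F u v) :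
    twist u v (diagGL h * x) = diagGL h * reducedTwist u v x := by
  have hg : ∃ p : (Fin n → Fˣ) × GL (Fin n) F,
      p.2 ∈ reducedCell F u v ∧ diagGL h * x = diagGL p.1 * p.2 := ⟨(h, x), hx, rfl⟩
  rw [twist, dif_pos hg]
  obtain ⟨h1, h2⟩ := hg.choose_spec
  have e := diagGL_eq_of_mul_eq hx h1 h2
  rw [← e] at h2 ⊢
  rw [← mul_left_cancel h2]

theorem mem_bruhatCell_of_mem_reducedCell {n : ℕ} {u v : Equiv.Perm (Fin n)} (h : Fin n → Fˣ)
    {x : GL (Fin n) F} (hx : x ∈ reducedCell F u v) : diagGL h * x ∈ bruhatCell F u v := by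
  obtain ⟨⟨b, hb, b', hb', rfl⟩, c, hc, c', hc', e⟩ := hx
  refine ⟨⟨diagGL h * b, upperB_mul (diagGL_mem_upperB h) hb.1, diagGL (colSign F u) * b',
    upperB_mul (diagGL_mem_upperB _) hb'.1, ?_⟩, diagGL h * c,
    lowerB_mul (diagGL_mem_lowerB h) hc, c', hc', ?_⟩
  · simp only [permLift, mul_assoc]
  · rw [e]
    simp only [mul_assoc]

end Twist

/-! ### The positive factorization -/

section Positive

variable {F : Type*} [DivisionRing F] {r : ℕ}

/-- If `p₀ = x p a \overline{u⁻¹}` with `x ∈ U`, `p ∈ B⁻` and `a` lower unitriangular, then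
`ū⁻¹ h ι(p₀)` has a Gauss decomposition whose lower triangular factor is known. -/
theorem permLift_inv_mul_iota {n : ℕ} {u : Equiv.Perm (Fin n)} {x p a : GL (Fin n) F}
    (hx : x ∈ upperU F n) (hp : p ∈ lowerB F n) (ha : a ∈ lowerU F n) (h : Fin n → Fˣ) :
    IsGauss ((permLift u)⁻¹ * (diagGL h * iota (x * p * (a * permLift u⁻¹))) * permLift 1)
      (diagGL (fun k => h (u k)) * (iota a * iota p)) (iota x) := by
  refine ⟨lowerB_mul (diagGL_mem_lowerB _) (lowerB_mul (iota_mem_lowerB ha.1)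
    (iota_mem_lowerB hp)), iota_mem_upperU hx, ?_⟩
  rw [permLift_one, mul_one, ← mul_assoc, permLift_inv_mul_diagGL, iota_mul, iota_mul, iota_mul,
    iota_permLift_inv]
  group

theorem Delta_diagGL_mul_iota {n : ℕ} {u : Equiv.Perm (Fin n)} {x p a : GL (Fin n) F}
    (hx : x ∈ upperU F n) (hp : p ∈ lowerB F n) (ha : a ∈ lowerU F n) (h : Fin n → Fˣ)
    (k : Fin n) :
    DeltaDefined k u 1 (diagGL h * iota (x * p * (a * permLift u⁻¹))).val ∧
    Delta k u 1 (diagGL h * iota (x * p * (a * permLift u⁻¹))).val =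
      h (u k) * (p.val k k)⁻¹ := by
  have := Delta_of_isGauss (permLift_inv_mul_iota (u := u) hx hp ha h) k
  rwa [diagGL_mul_apply, lowerB_mul_diag (iota_mem_lowerB ha.1) (iota_mem_lowerB hp),
    iota_lowerB_diag ha.1, iota_lowerB_diag hp, ha.2, inv_one, one_mul] at this

theorem listPos_gauss {L : List (Fin r × Fˣ)} (hL : IsReducedList (L.map Prod.fst))
    {w : Equiv.Perm (Fin (r + 1))} (hw : ((L.map Prod.fst).map simpleRefl).prod = w)
    {ρ : GL (Fin (r + 1)) F}
    (hρ : IsTwistedProd (fun i => permLift (simpleRefl i)) (L.map Prod.fst) ρ)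
    (h : listPos L * ρ ∈ lowerB F (r + 1)) :
    (∃ q, IsGauss (listPos L * permLift w⁻¹) (listPos L * ρ) q) ∧
      listPos L ∈ reducedCell F 1 w := by
  subst hw
  obtain ⟨⟨a, ha, h1⟩, b, hb, h2⟩ := hρ.eq_permLift_inv hL
  set w := ((L.map Prod.fst).map simpleRefl).prod
  refine ⟨⟨b⁻¹, h, upperU_inv hb, ?_⟩,
    ⟨⟨listPos L, listPos_mem_upperU L, 1, one_mem_upperU, by simp [permLift_one]⟩, ?_⟩⟩
  · rw [h2]
    group
  · obtain ⟨d, hd⟩ := (isMonomial_permLift (F := F) w⁻¹).inv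
    rw [inv_inv] at hd
    refine ⟨_, h, diagGL d * a⁻¹, lowerB_mul (diagGL_mem_lowerB _) (lowerB_inv ha.1), ?_⟩
    rw [← mul_assoc, mul_assoc _ (permGL w), ← hd, h1]
    group

theorem exists_listPos_gauss {L : List (Fin r × Fˣ)} (hL : IsReducedList (L.map Prod.fst))
    {w : Equiv.Perm (Fin (r + 1))} (hw : ((L.map Prod.fst).map simpleRefl).prod = w) :
    listPos L * permLift w⁻¹ ∈ gaussCell F (r + 1) ∧ listPos L ∈ reducedCell F 1 w := by
  obtain ⟨ρ, hρ, h⟩ := exists_listPos_mul_lowerB L (one_mem_lowerB (F := F))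
  rw [mul_one] at h
  obtain ⟨⟨q, hq⟩, h1⟩ := listPos_gauss hL hw hρ h
  exact ⟨⟨_, _, hq⟩, h1⟩

theorem reducedTwist_listPos (L : List (Fin r × Fˣ)) (w : Equiv.Perm (Fin (r + 1))) :
    reducedTwist 1 w (listPos L) = iota (gaussMinus (listPos L * permLift w⁻¹)) := by
  have h : IsGauss (listPos L) 1 (listPos L) :=
    ⟨one_mem_lowerB, listPos_mem_upperU L, (one_mul _).symm⟩
  rw [reducedTwist, permLift_one, inv_one, one_mul, h.gaussPlus_eq, inv_mul_cancel_right]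

/-- The factorization parameter at the place where the word splits: the two lower triangular
matrices `p₁`, `p₂` that belong to the suffixes with and without this place differ by the rank one
step `exists_xPos_mul_lowerB`, and their diagonal entries give the quasiminors of the twist. -/
theorem listPos_parameter (L₁ : List (Fin r × Fˣ)) (i : Fin r) (t : Fˣ) (L₂ : List (Fin r × Fˣ))
    (hL : IsReducedList ((L₁ ++ (i, t) :: L₂).map Prod.fst))
    {w u v : Equiv.Perm (Fin (r + 1))}
    (hw : (((L₁ ++ (i, t) :: L₂).map Prod.fst).map simpleRefl).prod = w)
    (hu : ((L₁.map Prod.fst).map simpleRefl).prod = u) (hv : u * simpleRefl i = v)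
    (h : Fin (r + 1) → Fˣ) {y : GL (Fin (r + 1)) F}
    (hy : y = diagGL h * iota (gaussMinus (listPos (L₁ ++ (i, t) :: L₂) * permLift w⁻¹))) :
    DeltaDefined i.castSucc v 1 y.val ∧ DeltaDefined i.succ u 1 y.val ∧
    DeltaDefined i.castSucc u 1 y.val ∧ DeltaDefined i.succ v 1 y.val ∧
    (t : F) = (Delta i.castSucc v 1 y.val)⁻¹ * Delta i.succ u 1 y.val ∧
    (t : F) = (Delta i.castSucc u 1 y.val)⁻¹ * Delta i.succ v 1 y.val := by
  obtain ⟨ρ₂, hρ₂, hp₂⟩ := exists_listPos_mul_lowerB L₂ (one_mem_lowerB (F := F))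
  set p₂ := listPos L₂ * 1 * ρ₂ with hp₂'
  obtain ⟨c, hp₁, hd, hd'⟩ := exists_xPos_mul_lowerB i t hp₂
  set p₁ := xPos i (t : F) * p₂ * (permLift (simpleRefl i) * xPos i c) with hp₁'
  obtain ⟨ρ₁, hρ₁, hp₀⟩ := exists_listPos_mul_lowerB L₁ hp₁
  have hρ : IsTwistedProd (fun i => permLift (simpleRefl i))
      ((L₁ ++ (i, t) :: L₂).map Prod.fst) (ρ₂ * (permLift (simpleRefl i) * xPos i c) * ρ₁) := by
    rw [List.map_append]
    exact hρ₁.append (hρ₂.cons c)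
  have e : listPos (L₁ ++ (i, t) :: L₂) * (ρ₂ * (permLift (simpleRefl i) * xPos i c) * ρ₁) =
      listPos L₁ * p₁ * ρ₁ := by
    simp [listPos, hp₁', hp₂', mul_assoc]
  obtain ⟨⟨q, hq⟩, -⟩ := listPos_gauss hL hw hρ (by rwa [e])
  rw [hq.gaussMinus_eq, e] at hy
  have hL₁ : IsReducedList (L₁.map Prod.fst) := by
    rw [List.map_append] at hL
    exact hL.append.1
  have hL₁' : IsReducedList ((L₁ ++ [(i, t)]).map Prod.fst) := by
    rw [show L₁ ++ (i, t) :: L₂ = (L₁ ++ [(i, t)]) ++ L₂ by simp, List.map_append] at hL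
    exact hL.append.1
  have hv' : (((L₁ ++ [(i, t)]).map Prod.fst).map simpleRefl).prod = v := by simp [← hv, ← hu]
  -- `y` seen from the shorter prefix
  obtain ⟨a₁, ha₁, e₁⟩ := (hρ₁.eq_permLift_inv hL₁).1
  rw [hu] at e₁
  have hy₁ : y = diagGL h * iota (listPos L₁ * p₁ * (a₁ * permLift u⁻¹)) := by rw [hy, e₁]
  -- `y` seen from the longer prefix
  have hρ₁' : IsTwistedProd (fun i => permLift (simpleRefl i)) ((L₁ ++ [(i, t)]).map Prod.fst)
      (permLift (simpleRefl i) * xPos i c * ρ₁) := by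
    rw [List.map_append]
    exact hρ₁.append (.singleton i c)
  obtain ⟨a₂, ha₂, e₂⟩ := (hρ₁'.eq_permLift_inv hL₁').1
  rw [hv'] at e₂
  have hy₂ : y = diagGL h * iota (listPos (L₁ ++ [(i, t)]) * p₂ * (a₂ * permLift v⁻¹)) := by
    rw [hy, ← e₂]
    simp [listPos, hp₁', mul_assoc]
  have D₁ := Delta_diagGL_mul_iota (u := u) (listPos_mem_upperU L₁) hp₁ ha₁ h
  have D₂ := Delta_diagGL_mul_iota (u := v) (listPos_mem_upperU (L₁ ++ [(i, t)])) hp₂ ha₂ h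
  rw [← hy₁] at D₁
  rw [← hy₂] at D₂
  refine ⟨(D₂ _).1, (D₁ _).1, (D₁ _).1, (D₂ _).1, ?_, ?_⟩
  · have hn := lowerB_diag_ne_zero hp₂ i.castSucc
    rw [(D₂ _).2, (D₁ _).2, hd', ← hv, Equiv.Perm.mul_apply, simpleRefl_castSucc, mul_inv_rev,
      inv_inv, mul_inv_rev, inv_inv]
    simp [mul_assoc, hn]
  · have hn := lowerB_diag_ne_zero hp₂ i.succ
    rw [(D₂ _).2, (D₁ _).2, hd, ← hv, Equiv.Perm.mul_apply, simpleRefl_succ, mul_inv_rev,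
      inv_inv]
    simp [mul_assoc, hn]

end Positive

/-! ### The negative factorization -/

section Negative

variable {F : Type*} [DivisionRing F] {r : ℕ}

theorem exists_listNeg_gauss {L : List (Fin r × Fˣ)} (hL : IsReducedList (L.map Prod.fst))
    {w : Equiv.Perm (Fin (r + 1))} (hw : ((L.map Prod.fst).map simpleRefl).prod = w)
    {ρ : GL (Fin (r + 1)) F}
    (hρ : IsTwistedProd (fun i => (permLift (simpleRefl i))⁻¹) (L.map Prod.fst) ρ)
    (h : ρ * listNeg L ∈ upperU F (r + 1)) :
    (∃ a ∈ lowerU F (r + 1), IsGauss ((permLift w)⁻¹ * listNeg L) a (ρ * listNeg L)) ∧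
      listNeg L ∈ reducedCell F w 1 := by
  subst hw
  obtain ⟨⟨a, ha, h1⟩, b, hb, h2⟩ := hρ.eq_inv_permLift hL
  set w := ((L.map Prod.fst).map simpleRefl).prod
  refine ⟨⟨a⁻¹, lowerU_inv ha, (lowerU_inv ha).1, h, ?_⟩, ⟨b⁻¹, upperU_inv hb, _, h, ?_⟩,
    listNeg L, listNeg_mem_lowerB L, 1, one_mem_lowerB, by simp [permGL_one]⟩
  · rw [h1]
    group
  · rw [h2]
    group

theorem reducedTwist_listNeg (L : List (Fin r × Fˣ)) (w : Equiv.Perm (Fin (r + 1))) :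
    reducedTwist w 1 (listNeg L) = iota (gaussPlus ((permLift w)⁻¹ * listNeg L)) := by
  have h : IsGauss (listNeg L) (listNeg L) 1 :=
    ⟨listNeg_mem_lowerB L, one_mem_upperU, (mul_one _).symm⟩
  rw [reducedTwist, inv_one, permLift_one, mul_one, h.gaussMinus_eq, mul_inv_cancel, one_mul]

theorem isGauss_diagGL_mul {n : ℕ} {w : Equiv.Perm (Fin n)} {x a q : GL (Fin n) F}
    (hg : IsGauss ((permLift w)⁻¹ * x) a q) (h : Fin n → Fˣ) :
    IsGauss ((permLift w)⁻¹ * (diagGL h * x)) (diagGL (fun k => h (w k)) * a) q :=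
  ⟨lowerB_mul (diagGL_mem_lowerB _) hg.1, hg.2.1, by
    rw [← mul_assoc, permLift_inv_mul_diagGL, mul_assoc, hg.2.2, mul_assoc]⟩

/-- The quasiminors of the twist are read off from the diagonal entries of the suffixes of the
product. -/
theorem listNeg_Delta {L₁ L₂ : List (Fin r × Fˣ)} (hL : IsReducedList ((L₁ ++ L₂).map Prod.fst))
    {w v : Equiv.Perm (Fin (r + 1))}
    (hw : (((L₁ ++ L₂).map Prod.fst).map simpleRefl).prod = w)
    (hv : ((L₂.map Prod.fst).map simpleRefl).prod⁻¹ = v)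
    {p q : GL (Fin (r + 1)) F} (hg : IsGauss ((permLift w)⁻¹ * listNeg (L₁ ++ L₂)) p q)
    (h : Fin (r + 1) → Fˣ) (k : Fin (r + 1)) :
    DeltaDefined k 1 v (diagGL h * iota q).val ∧
    Delta k 1 v (diagGL h * iota q).val = h k * ((listNeg L₂).val k k)⁻¹ := by
  obtain ⟨ρ₁, hρ₁, hq₁⟩ := exists_mul_listNeg_upperU L₁ (one_mem_upperU (F := F))
  obtain ⟨ρ₂, hρ₂, hq₂⟩ := exists_mul_listNeg_upperU L₂ hq₁
  set q₁ := ρ₁ * 1 * listNeg L₁ with hq₁'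
  have e : ρ₂ * ρ₁ * listNeg (L₁ ++ L₂) = ρ₂ * q₁ * listNeg L₂ := by
    simp [listNeg, hq₁', mul_assoc]
  have hρ : IsTwistedProd (fun i => (permLift (simpleRefl i))⁻¹) ((L₁ ++ L₂).map Prod.fst)
      (ρ₂ * ρ₁) := by
    rw [List.map_append]
    exact hρ₁.append hρ₂
  obtain ⟨⟨a, -, ha⟩, -⟩ := exists_listNeg_gauss hL hw hρ (by rwa [e])
  have hL₂ : IsReducedList (L₂.map Prod.fst) := by
    rw [List.map_append] at hL
    exact hL.append.2.1
  obtain ⟨b, hb, e₂⟩ := (hρ₂.eq_inv_permLift hL₂).2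
  have hq : q = (permLift v⁻¹)⁻¹ * (b * q₁) * listNeg L₂ := by
    rw [(hg.unique ha).2, e, e₂, ← hv, inv_inv]
    simp only [mul_assoc]
  have hG : IsGauss ((permLift 1)⁻¹ * (diagGL h * iota q) * permLift v)
      (diagGL h * iota (listNeg L₂)) (iota (b * q₁)) := by
    refine ⟨lowerB_mul (diagGL_mem_lowerB _) (iota_mem_lowerB (listNeg_mem_lowerB _)),
      iota_mem_upperU (upperU_mul hb hq₁), ?_⟩
    rw [hq, permLift_one, iota_mul, iota_mul, iota_inv, iota_permLift_inv]
    group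
  have := Delta_of_isGauss hG k
  rwa [diagGL_mul_apply, iota_lowerB_diag (listNeg_mem_lowerB _)] at this

theorem listNeg_parameter (L₁ : List (Fin r × Fˣ)) (i : Fin r) (t : Fˣ) (L₂ : List (Fin r × Fˣ))
    (hL : IsReducedList ((L₁ ++ (i, t) :: L₂).map Prod.fst))
    {w u v : Equiv.Perm (Fin (r + 1))}
    (hw : (((L₁ ++ (i, t) :: L₂).map Prod.fst).map simpleRefl).prod = w)
    (hv : ((L₂.map Prod.fst).map simpleRefl).prod⁻¹ = v)
    (hu : v * simpleRefl i = u)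
    {p q : GL (Fin (r + 1)) F}
    (hg : IsGauss ((permLift w)⁻¹ * listNeg (L₁ ++ (i, t) :: L₂)) p q)
    (h : Fin (r + 1) → Fˣ) {z : GL (Fin (r + 1)) F} (hz : z = diagGL h * iota q) :
    DeltaDefined i.castSucc 1 v z.val ∧ DeltaDefined i.castSucc 1 u z.val ∧
    DeltaDefined i.succ 1 u z.val ∧ DeltaDefined i.succ 1 v z.val ∧
    (t : F) = (Delta i.castSucc 1 v z.val)⁻¹ * Delta i.castSucc 1 u z.val ∧
    (t : F) = (Delta i.succ 1 u z.val)⁻¹ * Delta i.succ 1 v z.val := by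
  subst hz
  have D₁ := listNeg_Delta hL hw (v := u) (by simp [← hu, ← hv, simpleRefl_inv]) hg h
  rw [show L₁ ++ (i, t) :: L₂ = (L₁ ++ [(i, t)]) ++ L₂ by simp] at hL hw hg
  have D₂ := listNeg_Delta hL hw hv hg h
  have hd : ∀ k, (listNeg ((i, t) :: L₂)).val k k = (xNeg i t).val k k * (listNeg L₂).val k k := by
    intro k
    rw [← lowerB_mul_diag (xNeg_mem_lowerB i t) (listNeg_mem_lowerB L₂)]
    simp [listNeg]
  refine ⟨(D₂ _).1, (D₁ _).1, (D₁ _).1, (D₂ _).1, ?_, ?_⟩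
  · have hn := lowerB_diag_ne_zero (listNeg_mem_lowerB L₂) i.castSucc
    rw [(D₂ _).2, (D₁ _).2, hd, xNeg_castSucc]
    simp [mul_assoc, hn]
  · have hn := lowerB_diag_ne_zero (listNeg_mem_lowerB L₂) i.succ
    rw [(D₂ _).2, (D₁ _).2, hd, xNeg_succ]
    simp [mul_assoc, hn]

end Negative

/-! ### Words indexed by `Fin m` -/

section Words

variable {F : Type*} [DivisionRing F] {r m : ℕ}

theorem ofFn_split {α : Type*} (f : Fin m → α) (k : Fin m) :
    List.ofFn f = (List.ofFn f).take k ++ f k :: (List.ofFn f).drop (k + 1) := by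
  have hk : (k : ℕ) < (List.ofFn f).length := by simp
  conv_lhs => rw [← List.take_append_drop k (List.ofFn f), List.drop_eq_getElem_cons hk]
  simp

theorem reflList_eq (i : Fin m → Fin r) (t : Fin m → Fˣ) :
    reflList i = (((List.ofFn fun k => (i k, t k)).map Prod.fst).map simpleRefl) := by
  simp [reflList, List.map_ofFn, Function.comp_def]

theorem isReducedList_of_isReducedWord {i : Fin m → Fin r} {w : Equiv.Perm (Fin (r + 1))}
    (hi : IsReducedWord i w) (t : Fin m → Fˣ) :
    IsReducedList ((List.ofFn fun k => (i k, t k)).map Prod.fst) := by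
  rw [IsReducedList, ← reflList_eq i t, hi.1, hi.2]
  simp

theorem prefixProd_eq (i : Fin m → Fin r) (t : Fin m → Fˣ) (k : ℕ) :
    ((((List.ofFn fun k => (i k, t k)).take k).map Prod.fst).map simpleRefl).prod =
      prefixProd i k := by
  rw [prefixProd, reflList_eq i t, List.map_take, List.map_take]

theorem prefixProd_succ (i : Fin m → Fin r) (k : Fin m) :
    prefixProd i k * simpleRefl (i k) = prefixProd i (k + 1) := by
  have hk : (k : ℕ) < (reflList i).length := by simp [reflList]
  rw [prefixProd, prefixProd, List.take_succ_eq_append_getElem hk]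
  simp [reflList]

theorem revSuffixProd_eq (i : Fin m → Fin r) (t : Fin m → Fˣ) (k : ℕ) :
    ((((List.ofFn fun k => (i k, t k)).drop k).map Prod.fst).map simpleRefl).prod⁻¹ =
      revSuffixProd i k := by
  rw [revSuffixProd, reflList_eq i t, ← List.map_drop, ← List.map_drop, List.prod_inv_reverse,
    List.map_map]
  congr 3

theorem revSuffixProd_succ (i : Fin m → Fin r) (k : Fin m) :
    revSuffixProd i (k + 1) * simpleRefl (i k) = revSuffixProd i k := by
  have hk : (k : ℕ) < (reflList i).length := by simp [reflList]
  rw [revSuffixProd, revSuffixProd, List.drop_eq_getElem_cons hk]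
  simp [reflList]

theorem prodPos_eq (i : Fin m → Fin r) (t : Fin m → Fˣ) :
    prodPos i t = listPos (List.ofFn fun k => (i k, t k)) := by
  simp [prodPos, listPos, List.map_ofFn, Function.comp_def]

theorem prodNeg_eq (i : Fin m → Fin r) (t : Fin m → Fˣ) :
    prodNeg i t = listNeg (List.ofFn fun k => (i k, t k)) := by
  simp [prodNeg, listNeg, List.map_ofFn, Function.comp_def]

end Words

end NCTwist

theorem mainTheorem10 {F : Type*} [DivisionRing F] {r m : ℕ}
    (w : Equiv.Perm (Fin (r + 1))) (i : Fin m → Fin r) (hi : IsReducedWord i w)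
    (t : Fin m → Fˣ) (h : Fin (r + 1) → Fˣ) :
    -- the positive factorization
    (∀ x y : GL (Fin (r + 1)) F, x = diagGL h * prodPos i t → y = twist 1 w x →
      prodPos i t ∈ reducedCell F 1 w ∧ x ∈ bruhatCell F 1 w ∧
      prodPos i t * permLift w⁻¹ ∈ gaussCell F (r + 1) ∧
      y = diagGL h * iota (gaussMinus (prodPos i t * permLift w⁻¹)) ∧
      (∀ a : Fin (r + 1), DeltaDefined a 1 1 x.val ∧
        (h a : F) = Delta a 1 1 x.val ∧ (h a : F) = x.val a a) ∧
      ∀ k : Fin m,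
        DeltaDefined (i k).castSucc (prefixProd i (k + 1)) 1 y.val ∧
        DeltaDefined (i k).succ (prefixProd i k) 1 y.val ∧
        DeltaDefined (i k).castSucc (prefixProd i k) 1 y.val ∧
        DeltaDefined (i k).succ (prefixProd i (k + 1)) 1 y.val ∧
        (t k : F) = (Delta (i k).castSucc (prefixProd i (k + 1)) 1 y.val)⁻¹ *
          Delta (i k).succ (prefixProd i k) 1 y.val ∧
        (t k : F) = (Delta (i k).castSucc (prefixProd i k) 1 y.val)⁻¹ *
          Delta (i k).succ (prefixProd i (k + 1)) 1 y.val) ∧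
    -- the negative factorization
    (∀ x y : GL (Fin (r + 1)) F, x = diagGL h * prodNeg i t → y = twist w 1 x →
      prodNeg i t ∈ reducedCell F w 1 ∧ x ∈ bruhatCell F w 1 ∧
      (permLift w)⁻¹ * x ∈ gaussCell F (r + 1) ∧
      y = diagGL h * iota (gaussPlus ((permLift w)⁻¹ * x)) ∧
      (∀ a : Fin (r + 1), DeltaDefined (w⁻¹ a) w 1 x.val ∧
        (h a : F) = Delta (w⁻¹ a) w 1 x.val) ∧
      ∀ z : GL (Fin (r + 1)) F, z = y ∨ z = iota (gaussPlus ((permLift w)⁻¹ * x)) →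
      ∀ k : Fin m,
        DeltaDefined (i k).castSucc 1 (revSuffixProd i (k + 1)) z.val ∧
        DeltaDefined (i k).castSucc 1 (revSuffixProd i k) z.val ∧
        DeltaDefined (i k).succ 1 (revSuffixProd i k) z.val ∧
        DeltaDefined (i k).succ 1 (revSuffixProd i (k + 1)) z.val ∧
        (t k : F) = (Delta (i k).castSucc 1 (revSuffixProd i (k + 1)) z.val)⁻¹ *
          Delta (i k).castSucc 1 (revSuffixProd i k) z.val ∧
        (t k : F) = (Delta (i k).succ 1 (revSuffixProd i k) z.val)⁻¹ *
          Delta (i k).succ 1 (revSuffixProd i (k + 1)) z.val) := by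
  set L := List.ofFn fun k => (i k, t k) with hLdef
  have hL : IsReducedList (L.map Prod.fst) := isReducedList_of_isReducedWord hi t
  have hw : ((L.map Prod.fst).map simpleRefl).prod = w := by rw [← hi.1, reflList_eq i t]
  have hsplit : ∀ k : Fin m, L = L.take k ++ (i k, t k) :: L.drop (k + 1) := fun k =>
    ofFn_split (fun k => (i k, t k)) k
  rw [prodPos_eq, prodNeg_eq]
  refine ⟨?_, ?_⟩
  · rintro x y rfl hy
    obtain ⟨hgauss, hcell⟩ := exists_listPos_gauss (F := F) hL hw
    rw [twist_diagGL_mul h hcell, reducedTwist_listPos] at hy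
    refine ⟨hcell, mem_bruhatCell_of_mem_reducedCell h hcell, hgauss, hy, fun a => ?_,
      fun k => ?_⟩
    · have hx : (diagGL h * listPos L).val a a = h a := by
        rw [diagGL_mul_apply, (listPos_mem_upperU L).2, mul_one]
      have hG : IsGauss ((permLift 1)⁻¹ * (diagGL h * listPos L) * permLift 1) (diagGL h)
          (listPos L) :=
        ⟨diagGL_mem_lowerB h, listPos_mem_upperU L, by simp [permLift_one]⟩
      have hD := Delta_of_isGauss hG a
      rw [diagGL_diag] at hD
      exact ⟨hD.1, hD.2.symm, hx.symm⟩
    · have hk := hsplit k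
      rw [hk] at hL hw hy
      exact listPos_parameter (L.take k) (i k) (t k) (L.drop (k + 1)) hL hw
        (prefixProd_eq i t k) (prefixProd_succ i k) h hy
  · rintro x y rfl hy
    obtain ⟨ρ, hρ, hq⟩ := exists_mul_listNeg_upperU L (one_mem_upperU (F := F))
    rw [mul_one] at hq
    obtain ⟨⟨a, ha, hG⟩, hcell⟩ := exists_listNeg_gauss hL hw hρ hq
    have hGx := isGauss_diagGL_mul hG h
    rw [twist_diagGL_mul h hcell, reducedTwist_listNeg, hG.gaussPlus_eq] at hy
    rw [hGx.gaussPlus_eq]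
    refine ⟨hcell, mem_bruhatCell_of_mem_reducedCell h hcell, ⟨_, _, hGx⟩, hy, fun b => ?_,
      fun z hz k => ?_⟩
    · have hG₁ : IsGauss ((permLift w)⁻¹ * (diagGL h * listNeg L) * permLift 1)
          (diagGL (fun k => h (w k)) * a) (ρ * listNeg L) := by
        rwa [permLift_one, mul_one]
      have hD := Delta_of_isGauss hG₁ (w⁻¹ b)
      rw [diagGL_mul_apply, ha.2, mul_one, show w (w⁻¹ b) = b from w.apply_symm_apply b] at hD
      exact ⟨hD.1, hD.2.symm⟩
    · -- the parameters do not depend on the left factor in `H`, which may also be trivial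
      obtain ⟨h', hz'⟩ : ∃ h' : Fin (r + 1) → Fˣ,
          z = diagGL h' * iota (ρ * listNeg L) := by
        rcases hz with rfl | rfl
        · exact ⟨h, hy⟩
        · refine ⟨fun _ => 1, ?_⟩
          ext a b
          rw [diagGL_mul_apply, Units.val_one, one_mul]
      have hk := hsplit k
      -- `ρ` depends on the whole word, so that it must be hidden before the word is split
      generalize ρ * listNeg L = q at hG hz'
      rw [hk] at hL hw hG
      exact listNeg_parameter (L.take k) (i k) (t k) (L.drop (k + 1)) hL hw
        (revSuffixProd_eq i t (k + 1)) (revSuffixProd_succ i k) hG h' hz'
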